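/- Let $k$ be a field, let $\mathsf{c}$ be a small category, let $\mathcal{A}$ be a presheaf of associative $k$-algebras on $\mathsf{c}$, and let $\mathcal{F}, \mathcal{G}$ be presheaves of left $\mathcal{A}$-modules on $\mathsf{c}$; all presheaves are covariant functors. Let $\mathrm{Mor}\,\mathsf{c}$ be the category whose objects are the morphisms of $\mathsf{c}$ and in which a morphism from $f\colon c\to c'$ to $g\colon d\to d'$ is a pair $(\alpha\colon d\to c,\ \beta\colon c'\to d')$ with $\beta f\alpha=g$. For a functor $G$ from $\mathrm{Mor}\,\mathsf{c}$ to $k$-vector spaces, let $\mathsf{H}^*(\mathsf{c},G)$ be the cohomology of the resolving complex $$\mathsf{D}^p(\mathsf{c},G)=\prod_{c_0\xrightarrow{\phi_1}\cdots\xrightarrow{\phi_p}c_p}G(\phi_p\circ\cdots\circ\phi_1)\qquad(p\ge 0),$$ $$(dg)(\phi_1,\dots,\phi_{p+1})=G(\phi_1,\mathrm{id})\bigl(g(\phi_2,\dots,\phi_{p+1})\bigr)+\sum_{i=1}^{p}(-1)^i g(\phi_1,\dots,\phi_{i+1}\circ\phi_i,\dots,\phi_{p+1})+(-1)^{p+1}G(\mathrm{id},\phi_{p+1})\bigl(g(\phi_1,\dots,\phi_p)\bigr),$$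 where the composite of an empty chain at $c_0$ is $\mathrm{id}_{c_0}$. For $\phi\colon c\to c'$ let $\mathsf{HC}^*(\mathcal{A},\mathcal{H}om_k(\mathcal{F},\mathcal{G}))(\phi)$ be the Hochschild complex of the algebra $\mathcal{A}(c)$ with values in the bimodule $\mathrm{Hom}_k(\mathcal{F}(c),\mathcal{G}(c'))$, where $\mathcal{A}(c)$ acts on $\mathcal{G}(c')$ through $\mathcal{A}(\phi)$; this is a functor of $\phi\in\mathrm{Mor}\,\mathsf{c}$. Let $\mathcal{E}xt^q_{\mathcal{A}}(\mathcal{F},\mathcal{G})$ be the functor $\phi\mapsto \mathsf{H}^q\bigl(\mathsf{HC}^*(\mathcal{A},\mathcal{H}om_k(\mathcal{F},\mathcal{G}))(\phi)\bigr)$ on $\mathrm{Mor}\,\mathsf{c}$. Let the global Hochschild cohomology $\mathsf{HH}^*(\mathsf{c},\mathcal{A},\mathcal{H}om_k(\mathcal{F},\mathcal{G}))$ be the cohomology of the total complex of the double complex with terms $\mathsf{D}^p(\mathsf{c},\mathsf{HC}^q(\mathcal{A},\mathcal{H}om_k(\mathcal{F},\mathcal{G})))$, whose first differential is that of the resolving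 complex and whose second differential is $(-1)^p$ times the one induced by the Hochschild differential. Then there is a first quadrant cohomological spectral sequence $(E_r)_{r\ge 2}$ of $k$-vector spaces, with differentials $d_r\colon E_r^{pq}\to E_r^{p+r,q-r+1}$, such that $$E_2^{pq}\cong\mathsf{H}^p(\mathsf{c},\mathcal{E}xt^q_{\mathcal{A}}(\mathcal{F},\mathcal{G}))\qquad\text{for all } p,q\ge 0,$$ and on every $\mathsf{HH}^n=\mathsf{HH}^n(\mathsf{c},\mathcal{A},\mathcal{H}om_k(\mathcal{F},\mathcal{G}))$ there is a decreasing filtration $\mathsf{HH}^n=F^0\supseteq F^1\supseteq\cdots\supseteq F^{n+1}=0$ by subspaces such that $$E_\infty^{pq}\cong F^p\,\mathsf{HH}^{p+q}/F^{p+1}\,\mathsf{HH}^{p+q}\qquad\text{for all } p,q\ge 0.$$ -/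

import Mathlib

open CategoryTheory Simplicial

universe u

namespace GlobalHochschild

/-! ### The category of morphisms `Mor c` -/

/-- The objects of the category of morphisms of `C` are the morphisms of `C`. -/
structure Mor (C : Type u) [SmallCategory C] : Type u where
  /-- the source of the morphism -/
  src : C
  /-- the target of the morphism -/
  tgt : C
  /-- the morphism -/
  arrow : src ⟶ tgt

/-- A morphism from `f : c ⟶ c'` to `g : d ⟶ d'` in the category of morphisms is a pair
`α : d ⟶ c`, `β : c' ⟶ d'` with `β ∘ f ∘ α = g`. -/
@[ext]
structure Mor.Hom {C : Type u} [SmallCategory C] (f g : Mor C) : Type u where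
  /-- the component on sources, which is contravariant -/
  left : g.src ⟶ f.src
  /-- the component on targets -/
  right : f.tgt ⟶ g.tgt
  comm : left ≫ f.arrow ≫ right = g.arrow

instance Mor.category (C : Type u) [SmallCategory C] : Category.{u} (Mor C) where
  Hom f g := Mor.Hom f g
  id f := ⟨𝟙 _, 𝟙 _, by simp⟩
  comp {f g h} a b := ⟨b.left ≫ a.left, a.right ≫ b.right, by
    rw [← b.comm, ← a.comm]; simp⟩
  id_comp a := by apply Mor.Hom.ext <;> simp
  comp_id a := by apply Mor.Hom.ext <;> simp
  assoc a b c := by apply Mor.Hom.ext <;> simp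

@[simp] theorem Mor.id_left {C : Type u} [SmallCategory C] (f : Mor C) :
    Mor.Hom.left (𝟙 f) = 𝟙 _ := rfl

@[simp] theorem Mor.id_right {C : Type u} [SmallCategory C] (f : Mor C) :
    Mor.Hom.right (𝟙 f) = 𝟙 _ := rfl

@[simp] theorem Mor.comp_left {C : Type u} [SmallCategory C] {f g h : Mor C}
    (a : f ⟶ g) (b : g ⟶ h) : Mor.Hom.left (a ≫ b) = b.left ≫ a.left := rfl

@[simp] theorem Mor.comp_right {C : Type u} [SmallCategory C] {f g h : Mor C}
    (a : f ⟶ g) (b : g ⟶ h) : Mor.Hom.right (a ≫ b) = a.right ≫ b.right := rfl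

/-! ### The resolving complex -/

/-- The alternating sum of cofaces that satisfy the cosimplicial identities squares to zero. -/
theorem alternating_sum_sq {n : ℕ} {X Y Z : Type*} [AddCommGroup X] [AddCommGroup Y]
    [AddCommGroup Z] (δ : Fin (n + 2) → X →+ Y) (δ' : Fin (n + 3) → Y →+ Z)
    (h : ∀ i j : Fin (n + 2), i ≤ j → ∀ x, δ' j.succ (δ i x) = δ' i.castSucc (δ j x)) (x : X) :
    ∑ j : Fin (n + 3), (-1 : ℤ) ^ (j : ℕ) •
      δ' j (∑ i : Fin (n + 2), (-1 : ℤ) ^ (i : ℕ) • δ i x) = 0 := by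
  simp only [map_sum, map_zsmul, Finset.smul_sum, smul_smul]
  rw [Finset.sum_comm]
  simp only [← Finset.sum_product']
  let P := Fin (n + 2) × Fin (n + 3)
  let S : Finset P := Finset.univ.filter fun ij => (ij.2 : ℕ) ≤ (ij.1 : ℕ)
  rw [Finset.univ_product_univ, ← Finset.sum_add_sum_compl S, ← eq_neg_iff_add_eq_zero,
    ← Finset.sum_neg_distrib]
  let φ : ∀ ij : P, ij ∈ S → P := fun ij hij =>
    (Fin.castLT ij.2 (lt_of_le_of_lt (Finset.mem_filter.mp hij).right (Fin.is_lt ij.1)),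
      ij.1.succ)
  apply Finset.sum_bij φ
  · intro ij hij
    simp_rw [S, φ, Finset.compl_filter, Finset.mem_filter_univ, Fin.val_succ,
      Fin.val_castLT] at hij ⊢
    lia
  · rintro ⟨i, j⟩ hij ⟨i', j'⟩ hij' h
    rw [Prod.mk_inj]
    exact ⟨by simpa [φ] using! congr_arg Prod.snd h,
      by simpa [φ, Fin.castSucc_castLT] using! congr_arg Fin.castSucc (congr_arg Prod.fst h)⟩
  · rintro ⟨i', j'⟩ hij'
    simp_rw [S, Finset.compl_filter, Finset.mem_filter_univ, not_le] at hij'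
    refine ⟨(j'.pred <| ?_, Fin.castSucc i'), ?_, ?_⟩
    · rintro rfl
      simp only [Fin.val_zero, not_lt_zero] at hij'
    · simpa [S] using! Nat.le_sub_one_of_lt hij'
    · simp only [φ, Fin.castLT_castSucc, Fin.succ_pred]
  · rintro ⟨i, j⟩ hij
    have hle : (j : ℕ) ≤ (i : ℕ) := by simpa [S] using! hij
    have key := h (Fin.castLT j (by lia)) i (by rw [Fin.le_def]; simpa using hle) x
    simp only [φ, Fin.val_succ, Fin.val_castLT]
    rw [key, Fin.castSucc_castLT, ← neg_smul]
    congr 1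
    ring

/-- The composite `φₚ ∘ ⋯ ∘ φ₁` of a chain of `p` composable morphisms
`c₀ ⟶ c₁ ⟶ ⋯ ⟶ cₚ`, as an object of the category of morphisms (an identity if `p = 0`). -/
def composite {C : Type u} [SmallCategory C] {p : ℕ} (x : ComposableArrows C p) : Mor C :=
  ⟨x.left, x.right, x.hom⟩

/-- The chain obtained from a chain of `n` morphisms by means of a monotone map
`θ : {0, …, m} → {0, …, n}`. If `m = n - 1` and `θ` is the injection that omits `i`, this drops the
object `cᵢ`: it forgets `φ₁` if `i = 0` and `φₙ` if `i = n`, and otherwise it replaces the pair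
`φᵢ, φᵢ₊₁` by its composite `φᵢ₊₁ ∘ φᵢ`. -/
abbrev reindex {C : Type u} [SmallCategory C] {m n : ℕ} (θ : Fin (m + 1) →o Fin (n + 1))
    (x : ComposableArrows C n) : ComposableArrows C m :=
  x.whiskerLeft θ.monotone.functor

/-- The canonical morphism `(α, β)` in the category of morphisms from the composite of a reindexed
chain to the composite of the chain, where `α : c₀ ⟶ c_{θ(0)}` and `β : c_{θ(m)} ⟶ cₙ` are
composites of the morphisms of the chain. If `θ` is the injection that omits `i`, this is
`(φ₁, id)` if `i = 0`, `(id, φₙ)` if `i = n`, and an identity otherwise. -/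
def reindexHom {C : Type u} [SmallCategory C] {m n : ℕ} (θ : Fin (m + 1) →o Fin (n + 1))
    (x : ComposableArrows C n) : composite (reindex θ x) ⟶ composite x where
  left := x.map (homOfLE (Fin.zero_le _))
  right := x.map (homOfLE (Fin.le_last _))
  comm := by
    dsimp [composite, ComposableArrows.hom, ComposableArrows.map']
    erw [← x.map_comp, ← x.map_comp]
    congr 1

theorem reindexHom_comp {C : Type u} [SmallCategory C] {l m n : ℕ}
    (θ : Fin (l + 1) →o Fin (m + 1)) (θ' : Fin (m + 1) →o Fin (n + 1))
    (x : ComposableArrows C n) :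
    reindexHom (θ'.comp θ) x =
      (reindexHom θ (reindex θ' x) ≫ reindexHom θ' x : composite (reindex θ (reindex θ' x)) ⟶ _) :=
  Mor.Hom.ext (x.map_comp _ _) (x.map_comp _ _)

variable {k : Type u} [Field k] {C : Type u} [SmallCategory C]

/-- The product of the modules `G(φₚ ∘ ⋯ ∘ φ₁)` over all chains of `p` composable morphisms. -/
abbrev Cochain (G : Mor C ⥤ ModuleCat.{u} k) (p : ℕ) : Type u :=
  ∀ x : ComposableArrows C p, G.obj (composite x)

/-- The map on cochains induced by a monotone map. -/
def Cochain.map (G : Mor C ⥤ ModuleCat.{u} k) {m n : ℕ} (θ : Fin (m + 1) →o Fin (n + 1)) :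
    Cochain G m →ₗ[k] Cochain G n :=
  LinearMap.pi fun x => (G.map (reindexHom θ x)).hom ∘ₗ LinearMap.proj (reindex θ x)

theorem Cochain.map_map (G : Mor C ⥤ ModuleCat.{u} k) {l m n : ℕ}
    (θ : Fin (l + 1) →o Fin (m + 1)) (θ' : Fin (m + 1) →o Fin (n + 1)) (g : Cochain G l) :
    Cochain.map G θ' (Cochain.map G θ g) = Cochain.map G (θ'.comp θ) g := by
  funext x
  have h := congrArg (fun t => (G.map t).hom (g (reindex θ (reindex θ' x))))
    (reindexHom_comp θ θ' x)
  refine Eq.trans ?_ h.symm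
  exact (congrArg (fun t : G.obj (composite (reindex θ (reindex θ' x))) ⟶ G.obj (composite x) =>
    t.hom (g (reindex θ (reindex θ' x)))) (G.map_comp _ _)).symm

/-- The differential of the resolving complex,
`(dg)(φ₁, …, φₚ₊₁) = G(φ₁, id)(g(φ₂, …, φₚ₊₁)) + ∑ (-1)ⁱ g(φ₁, …, φᵢ₊₁ ∘ φᵢ, …, φₚ₊₁)
  + (-1)ᵖ⁺¹ G(id, φₚ₊₁)(g(φ₁, …, φₚ))`. -/
def Cochain.d (G : Mor C ⥤ ModuleCat.{u} k) (p : ℕ) : Cochain G p →ₗ[k] Cochain G (p + 1) :=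
  ∑ i : Fin (p + 2), (-1 : ℤ) ^ (i : ℕ) • Cochain.map G i.succAboveOrderEmb.toOrderHom

theorem Cochain.d_apply (G : Mor C ⥤ ModuleCat.{u} k) (p : ℕ) (g : Cochain G p) :
    Cochain.d G p g =
      ∑ i : Fin (p + 2), (-1 : ℤ) ^ (i : ℕ) • Cochain.map G i.succAboveOrderEmb.toOrderHom g := by
  simp [Cochain.d]

theorem Cochain.d_d (G : Mor C ⥤ ModuleCat.{u} k) (p : ℕ) (g : Cochain G p) :
    Cochain.d G (p + 1) (Cochain.d G p g) = 0 := by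
  rw [Cochain.d_apply, Cochain.d_apply]
  refine alternating_sum_sq
    (fun i => (Cochain.map G i.succAboveOrderEmb.toOrderHom).toAddMonoidHom)
    (fun i => (Cochain.map G i.succAboveOrderEmb.toOrderHom).toAddMonoidHom) ?_ g
  intro i j hij g
  refine (Cochain.map_map G _ _ g).trans (Eq.trans ?_ (Cochain.map_map G _ _ g).symm)
  congr 2
  ext a
  simp only [OrderHom.comp_coe, Function.comp_apply, OrderEmbedding.toOrderHom_coe,
    Fin.succAboveOrderEmb_apply, Fin.succAbove, Fin.lt_def, Fin.le_def] at *
  split_ifs <;> simp at * <;> lia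

/-- The map on cochains induced by a morphism of functors. -/
def Cochain.push {G H : Mor C ⥤ ModuleCat.{u} k} (η : G ⟶ H) (p : ℕ) :
    Cochain G p →ₗ[k] Cochain H p :=
  LinearMap.pi fun x => (η.app (composite x)).hom ∘ₗ LinearMap.proj x

theorem Cochain.push_d {G H : Mor C ⥤ ModuleCat.{u} k} (η : G ⟶ H) (p : ℕ) (g : Cochain G p) :
    Cochain.d H p (Cochain.push η p g) = Cochain.push η (p + 1) (Cochain.d G p g) := by
  simp only [Cochain.d_apply, map_sum, map_zsmul]
  refine Finset.sum_congr rfl fun i _ => congrArg _ ?_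
  funext x
  exact (congrArg (fun t : G.obj _ ⟶ H.obj _ => t.hom (g _))
    (η.naturality (reindexHom i.succAboveOrderEmb.toOrderHom x))).symm

/-- The resolving complex `D^*(c, G)`. -/
def resolvingComplex (G : Mor C ⥤ ModuleCat.{u} k) : CochainComplex (ModuleCat.{u} k) ℕ :=
  CochainComplex.of (fun p => ModuleCat.of k (Cochain G p))
    (fun p => ModuleCat.ofHom (Cochain.d G p)) (fun p => by
      ext g : 2
      exact Cochain.d_d G p g)

theorem resolvingComplex_d (G : Mor C ⥤ ModuleCat.{u} k) (p : ℕ) :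
    (resolvingComplex G).d p (p + 1) = ModuleCat.ofHom (Cochain.d G p) := by
  simp [resolvingComplex]

/-- The map of resolving complexes induced by a morphism of functors. -/
def resolvingComplexMap {G H : Mor C ⥤ ModuleCat.{u} k} (η : G ⟶ H) :
    resolvingComplex G ⟶ resolvingComplex H :=
  CochainComplex.ofHom (fun p => ModuleCat.ofHom (Cochain.push η p)) (fun p => by
    rw [resolvingComplex_d, resolvingComplex_d]
    ext g : 2
    exact Cochain.push_d η p g)

/-- `H^p(c, G)`, the cohomology of the resolving complex. -/
noncomputable def resolvingCohomology (G : Mor C ⥤ ModuleCat.{u} k) (p : ℕ) : ModuleCat.{u} k :=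
  (resolvingComplex G).homology p

/-- The differential `K^q ⟶ K^q'` of a functor `K` from the category of morphisms to complexes. -/
def complexDiff (K : Mor C ⥤ CochainComplex (ModuleCat.{u} k) ℕ) (q q' : ℕ) :
    K ⋙ HomologicalComplex.eval _ _ q ⟶ K ⋙ HomologicalComplex.eval _ _ q' where
  app f := (K.obj f).d q q'
  naturality _ _ a := (K.map a).comm q q'

/-- For a functor `K` from the category of morphisms to complexes, the double complex with
`(p, q)`-term `D^p(c, K^q)`. The first differential is that of the resolving complex, the second one
is induced by the differential of `K` (the sign `(-1)^p` enters in the total complex). -/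
def resolvingBicomplex (K : Mor C ⥤ CochainComplex (ModuleCat.{u} k) ℕ) :
    HomologicalComplex₂ (ModuleCat.{u} k) (ComplexShape.up ℕ) (ComplexShape.up ℕ) where
  X p :=
    { X q := (resolvingComplex (K ⋙ HomologicalComplex.eval _ _ q)).X p
      d q q' := (resolvingComplexMap (complexDiff K q q')).f p
      shape q q' h := by
        ext g : 2
        funext x
        change ((K.obj (composite x)).d q q').hom (g x) = 0
        rw [(K.obj (composite x)).shape q q' h]
        rfl
      d_comp_d' q q' q'' _ _ := by
        ext g : 2
        funext x
        exact congrArg (fun t : (K.obj (composite x)).X q ⟶ (K.obj (composite x)).X q'' =>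
          t.hom (g x)) ((K.obj (composite x)).d_comp_d q q' q'') }
  d p p' :=
    { f q := (resolvingComplex (K ⋙ HomologicalComplex.eval _ _ q)).d p p'
      comm' q q' _ := ((resolvingComplexMap (complexDiff K q q')).comm p p').symm }
  shape p p' h := by
    ext q : 1
    exact (resolvingComplex (K ⋙ HomologicalComplex.eval _ _ q)).shape p p' h
  d_comp_d' p p' p'' _ _ := by
    ext q : 1
    exact (resolvingComplex (K ⋙ HomologicalComplex.eval _ _ q)).d_comp_d p p' p''

/-! ### The Hochschild complex -/

section Hochschild

variable {R X Y : Type u} [Ring R] [Algebra k R] [AddCommGroup X] [Module k X]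
  [AddCommGroup Y] [Module k Y]

/-- Multiplying two consecutive entries of a tuple turns a change of one entry into a change of one
entry that depends linearly on it. -/
theorem contractNth_update {n : ℕ} (j : Fin n) (a : Fin (n + 1) → R) (m : Fin (n + 1)) :
    ∃ (l : Fin n) (t : R →ₗ[k] R), ∀ x : R,
      Fin.contractNth j.castSucc (· * ·) (Function.update a m x) =
        Function.update (Fin.contractNth j.castSucc (· * ·) a) l (t x) := by
  rcases lt_trichotomy (m : ℕ) (j : ℕ) with h | h | h
  · refine ⟨⟨m, by lia⟩, LinearMap.id, fun x => ?_⟩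
    funext i
    simp only [Fin.contractNth, Function.update_apply, Fin.ext_iff, Fin.val_castSucc, Fin.val_succ,
      LinearMap.id_apply]
    split_ifs <;> first | rfl | lia
  · refine ⟨j, LinearMap.mulRight k (a j.succ), fun x => ?_⟩
    funext i
    simp only [Fin.contractNth, Function.update_apply, Fin.ext_iff, Fin.val_castSucc, Fin.val_succ,
      LinearMap.mulRight_apply]
    split_ifs <;> first | rfl | lia | skip
    obtain rfl : i = j := by ext; lia
    rfl
  · by_cases h' : (m : ℕ) = j + 1
    · refine ⟨j, LinearMap.mulLeft k (a j.castSucc), fun x => ?_⟩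
      funext i
      simp only [Fin.contractNth, Function.update_apply, Fin.ext_iff, Fin.val_castSucc,
        Fin.val_succ, LinearMap.mulLeft_apply]
      split_ifs <;> first | rfl | lia | skip
      obtain rfl : i = j := by ext; lia
      rfl
    · refine ⟨⟨m - 1, by lia⟩, LinearMap.id, fun x => ?_⟩
      funext i
      simp only [Fin.contractNth, Function.update_apply, Fin.ext_iff, Fin.val_castSucc,
        Fin.val_succ, LinearMap.id_apply]
      split_ifs <;> first | rfl | lia

/-- The cochain `(a₀, …, aₙ) ↦ f(a₀, …, aⱼ aⱼ₊₁, …, aₙ)`. -/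
def hochContract {n : ℕ} (j : Fin n) (f : MultilinearMap k (fun _ : Fin n => R) (X →ₗ[k] Y)) :
    MultilinearMap k (fun _ : Fin (n + 1) => R) (X →ₗ[k] Y) where
  toFun a := f (Fin.contractNth j.castSucc (· * ·) a)
  map_update_add' {dec} a m x y := by
    obtain rfl : dec = instDecidableEqFin _ := Subsingleton.elim _ _
    obtain ⟨l, t, h⟩ := contractNth_update (k := k) j a m
    simp only [h, map_add, MultilinearMap.map_update_add]
  map_update_smul' {dec} a m c x := by
    obtain rfl : dec = instDecidableEqFin _ := Subsingleton.elim _ _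
    obtain ⟨l, t, h⟩ := contractNth_update (k := k) j a m
    simp only [h, map_smul, MultilinearMap.map_update_smul]

/-- The cochain `(a₀, …, aₙ) ↦ a₀ f(a₁, …, aₙ)`, where `R` acts on `Hom(X, Y)` from the left by
means of its action `σ` on `Y`. -/
def hochLeft (σ : R →ₐ[k] Module.End k Y) {n : ℕ}
    (f : MultilinearMap k (fun _ : Fin n => R) (X →ₗ[k] Y)) :
    MultilinearMap k (fun _ : Fin (n + 1) => R) (X →ₗ[k] Y) where
  toFun a := σ (a 0) ∘ₗ f (Fin.tail a)
  map_update_add' {dec} a m x y := by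
    obtain rfl : dec = instDecidableEqFin _ := Subsingleton.elim _ _
    cases m using Fin.cases with
    | zero => simp [LinearMap.add_comp]
    | succ m =>
      have h (z : R) : Function.update a m.succ z 0 = a 0 :=
        Function.update_of_ne (Fin.succ_ne_zero m).symm _ _
      simp [Fin.tail_update_succ, LinearMap.comp_add, h]
  map_update_smul' {dec} a m c x := by
    obtain rfl : dec = instDecidableEqFin _ := Subsingleton.elim _ _
    cases m using Fin.cases with
    | zero => simp [LinearMap.smul_comp]
    | succ m =>
      have h (z : R) : Function.update a m.succ z 0 = a 0 :=
        Function.update_of_ne (Fin.succ_ne_zero m).symm _ _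
      simp [Fin.tail_update_succ, LinearMap.comp_smul, h]

/-- The cochain `(a₀, …, aₙ) ↦ f(a₀, …, aₙ₋₁) aₙ`, where `R` acts on `Hom(X, Y)` from the right by
means of its action `ρ` on `X`. -/
def hochRight (ρ : R →ₐ[k] Module.End k X) {n : ℕ}
    (f : MultilinearMap k (fun _ : Fin n => R) (X →ₗ[k] Y)) :
    MultilinearMap k (fun _ : Fin (n + 1) => R) (X →ₗ[k] Y) where
  toFun a := f (Fin.init a) ∘ₗ ρ (a (Fin.last n))
  map_update_add' {dec} a m x y := by
    obtain rfl : dec = instDecidableEqFin _ := Subsingleton.elim _ _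
    cases m using Fin.lastCases with
    | last => simp [LinearMap.comp_add]
    | cast m =>
      have h (z : R) : Function.update a m.castSucc z (Fin.last n) = a (Fin.last n) :=
        Function.update_of_ne (Fin.castSucc_ne_last m).symm _ _
      simp [Fin.init_update_castSucc, LinearMap.add_comp, h]
  map_update_smul' {dec} a m c x := by
    obtain rfl : dec = instDecidableEqFin _ := Subsingleton.elim _ _
    cases m using Fin.lastCases with
    | last => simp [LinearMap.comp_smul]
    | cast m =>
      have h (z : R) : Function.update a m.castSucc z (Fin.last n) = a (Fin.last n) :=
        Function.update_of_ne (Fin.castSucc_ne_last m).symm _ _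
      simp [Fin.init_update_castSucc, LinearMap.smul_comp, h]

/-- The Hochschild differential on `HC^n(R, Hom(X, Y))`, where `X` and `Y` are left `R`-modules with
actions `ρ` and `σ`, and `n`-cochains are multilinear maps `Rⁿ → Hom(X, Y)`:
`(df)(a₁, …, aₙ₊₁) = a₁ f(a₂, …, aₙ₊₁) + ∑ (-1)ⁱ f(a₁, …, aᵢ aᵢ₊₁, …, aₙ₊₁)
  + (-1)ⁿ⁺¹ f(a₁, …, aₙ) aₙ₊₁`, the sum being over `1 ≤ i ≤ n`. -/
def hochD (ρ : R →ₐ[k] Module.End k X) (σ : R →ₐ[k] Module.End k Y) (n : ℕ) :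
    MultilinearMap k (fun _ : Fin n => R) (X →ₗ[k] Y) →ₗ[k]
      MultilinearMap k (fun _ : Fin (n + 1) => R) (X →ₗ[k] Y) where
  toFun f := hochLeft σ f + ∑ j : Fin n, (-1 : ℤ) ^ ((j : ℕ) + 1) • hochContract j f +
    (-1 : ℤ) ^ (n + 1) • hochRight ρ f
  map_add' f g := by
    have hl : hochLeft σ (f + g) = hochLeft σ f + hochLeft σ g := by
      ext a x; simp [hochLeft]
    have hc (j : Fin n) : hochContract j (f + g) = hochContract j f + hochContract j g := by
      ext a x; simp [hochContract]
    have hr : hochRight ρ (f + g) = hochRight ρ f + hochRight ρ g := by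
      ext a x; simp [hochRight]
    simp only [hl, hc, hr, smul_add, Finset.sum_add_distrib]
    abel
  map_smul' c f := by
    have hl : hochLeft σ (c • f) = c • hochLeft σ f := by
      ext a x; simp [hochLeft]
    have hc (j : Fin n) : hochContract j (c • f) = c • hochContract j f := by
      ext a x; simp [hochContract]
    have hr : hochRight ρ (c • f) = c • hochRight ρ f := by
      ext a x; simp [hochRight]
    simp only [hl, hc, hr, smul_add, Finset.smul_sum, smul_comm c, RingHom.id_apply]

theorem hochD_apply (ρ : R →ₐ[k] Module.End k X) (σ : R →ₐ[k] Module.End k Y) (n : ℕ)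
    (f : MultilinearMap k (fun _ : Fin n => R) (X →ₗ[k] Y)) (a : Fin (n + 1) → R) (x : X) :
    hochD ρ σ n f a x = σ (a 0) (f (Fin.tail a) x) +
      ∑ j : Fin n, (-1 : ℤ) ^ ((j : ℕ) + 1) • f (Fin.contractNth j.castSucc (· * ·) a) x +
      (-1 : ℤ) ^ (n + 1) • f (Fin.init a) (ρ (a (Fin.last n)) x) := by
  change (hochLeft σ f + ∑ j : Fin n, (-1 : ℤ) ^ ((j : ℕ) + 1) • hochContract j f +
    (-1 : ℤ) ^ (n + 1) • hochRight ρ f) a x = _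
  simp only [add_apply, sum_apply, smul_apply, LinearMap.add_apply, LinearMap.sum_apply,
    LinearMap.smul_apply]
  rfl

/-- Auxiliary to `hochD_hochD`: the effect of the `i`-th coface on the arguments of a cochain. -/
def hochArg {n : ℕ} (i : Fin (n + 2)) (a : Fin (n + 1) → R) (j : Fin n) : R :=
  if (j : ℕ) + 1 < i then a j.castSucc
  else if (j : ℕ) + 1 = i then a j.castSucc * a j.succ else a j.succ

/-- Auxiliary to `hochD_hochD`: all the cofaces in a uniform way. -/
def hochCoface (ρ : R →ₐ[k] Module.End k X) (σ : R →ₐ[k] Module.End k Y) {n : ℕ}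
    (i : Fin (n + 2)) : ((Fin n → R) → (X →ₗ[k] Y)) →+ ((Fin (n + 1) → R) → (X →ₗ[k] Y)) where
  toFun f a := σ (if (i : ℕ) = 0 then a 0 else 1) ∘ₗ f (hochArg i a) ∘ₗ
    ρ (if (i : ℕ) = n + 1 then a (Fin.last n) else 1)
  map_zero' := by ext; simp
  map_add' f g := by ext; simp

theorem hochD_eq_sum (ρ : R →ₐ[k] Module.End k X) (σ : R →ₐ[k] Module.End k Y) {n : ℕ}
    (f : MultilinearMap k (fun _ : Fin n => R) (X →ₗ[k] Y)) :
    (hochD ρ σ n f : (Fin (n + 1) → R) → (X →ₗ[k] Y)) =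
      ∑ i : Fin (n + 2), (-1 : ℤ) ^ (i : ℕ) • hochCoface ρ σ i f := by
  have h0 : hochCoface ρ σ 0 f = hochLeft σ f := by
    funext a
    have : hochArg (0 : Fin (n + 2)) a = Fin.tail a := by
      funext j; simp [hochArg, Fin.tail]
    ext x
    simp [hochCoface, hochLeft, this]
  have hj (j : Fin n) : hochCoface ρ σ j.castSucc.succ f = hochContract j f := by
    funext a
    have : hochArg j.castSucc.succ a = Fin.contractNth j.castSucc (· * ·) a := by
      funext i; simp [hochArg, Fin.contractNth]
    ext x
    have h' := j.isLt.ne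
    simp [hochCoface, hochContract, this, h']
  have hl : hochCoface ρ σ (Fin.last (n + 1)) f = hochRight ρ f := by
    funext a
    have : hochArg (Fin.last (n + 1)) a = Fin.init a := by
      funext j; simp [hochArg, Fin.init]
    ext x
    simp [hochCoface, hochRight, this]
  rw [Fin.sum_univ_succ, Fin.sum_univ_castSucc, ← add_assoc]
  simp only [Fin.succ_last, h0, hj, hl]
  funext a
  simp [hochD]

theorem hochD_hochD (ρ : R →ₐ[k] Module.End k X) (σ : R →ₐ[k] Module.End k Y) (n : ℕ)
    (f : MultilinearMap k (fun _ : Fin n => R) (X →ₗ[k] Y)) :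
    hochD ρ σ (n + 1) (hochD ρ σ n f) = 0 := by
  apply DFunLike.coe_injective
  rw [hochD_eq_sum, hochD_eq_sum]
  refine alternating_sum_sq _ _ ?_ _
  intro i j hij f
  funext a
  rw [Fin.le_def] at hij
  have hL : (if (i : ℕ) = 0 then hochArg j.succ a 0 else 1) =
      (if (i : ℕ) = 0 then a 0 else 1) * (if (j : ℕ) = 0 then hochArg i.castSucc a 0 else 1) := by
    by_cases hj : (j : ℕ) = 0
    · simp [show (i : ℕ) = 0 by lia, hj, hochArg]
    · simp [hj, hochArg, Nat.pos_of_ne_zero hj]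
  have hR : (if (i : ℕ) = n + 1 then hochArg j.succ a (Fin.last n) else 1) *
      (if (j : ℕ) = n + 1 then a (Fin.last (n + 1)) else 1) =
      (if (j : ℕ) = n + 1 then hochArg i.castSucc a (Fin.last n) else 1) := by
    by_cases hj : (j : ℕ) = n + 1
    · by_cases hi : (i : ℕ) = n + 1
      · simp [hi, hj, hochArg]
      · simp [hi, hj, hochArg, show ¬ (n + 1 < (i : ℕ)) by lia, show ¬ (n + 1 = (i : ℕ)) by lia]
    · simp [hj, show ¬ ((i : ℕ) = n + 1) by lia]
  have hM : hochArg i (hochArg j.succ a) = hochArg j (hochArg i.castSucc a) := by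
    funext l
    simp only [hochArg, Fin.val_succ, Fin.val_castSucc, Fin.succ_castSucc]
    grind only [mul_assoc]
  have hL' := congrArg σ hL
  have hR' := congrArg ρ hR
  rw [map_mul] at hL' hR'
  ext x
  have hR'' := congrArg (fun t : Module.End k X => t x) hR'
  simp only [Module.End.mul_apply] at hR''
  change σ (if ((j.succ : Fin (n + 3)) : ℕ) = 0 then a 0 else 1)
      (σ (if (i : ℕ) = 0 then hochArg j.succ a 0 else 1) (f (hochArg i (hochArg j.succ a))
        (ρ (if (i : ℕ) = n + 1 then hochArg j.succ a (Fin.last n) else 1)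
          (ρ (if ((j.succ : Fin (n + 3)) : ℕ) = n + 1 + 1 then a (Fin.last (n + 1)) else 1) x)))) =
    σ (if ((i.castSucc : Fin (n + 3)) : ℕ) = 0 then a 0 else 1)
      (σ (if (j : ℕ) = 0 then hochArg i.castSucc a 0 else 1)
        (f (hochArg j (hochArg i.castSucc a))
          (ρ (if (j : ℕ) = n + 1 then hochArg i.castSucc a (Fin.last n) else 1)
            (ρ (if ((i.castSucc : Fin (n + 3)) : ℕ) = n + 1 + 1 then a (Fin.last (n + 1)) else 1)
              x))))
  have hi : ¬ (i : ℕ) = n + 1 + 1 := by lia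
  simp only [Fin.val_succ, Fin.val_castSucc, Nat.add_right_cancel_iff, Nat.add_eq_zero_iff,
    one_ne_zero, and_false, if_false, hi, map_one, Module.End.one_apply]
  rw [hR'', ← Module.End.mul_apply, ← hL', hM]

/-- The Hochschild complex `HC^*(R, Hom(X, Y))`, where `X` and `Y` are left `R`-modules with actions
`ρ` and `σ`. -/
def hochschildComplex (ρ : R →ₐ[k] Module.End k X) (σ : R →ₐ[k] Module.End k Y) :
    CochainComplex (ModuleCat.{u} k) ℕ :=
  CochainComplex.of
    (fun n => ModuleCat.of k (MultilinearMap k (fun _ : Fin n => R) (X →ₗ[k] Y)))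
    (fun n => ModuleCat.ofHom (hochD ρ σ n)) (fun n => by
      ext f : 2
      exact hochD_hochD ρ σ n f)

theorem hochschildComplex_d (ρ : R →ₐ[k] Module.End k X) (σ : R →ₐ[k] Module.End k Y) (n : ℕ) :
    (hochschildComplex ρ σ).d n (n + 1) = ModuleCat.ofHom (hochD ρ σ n) := by
  simp [hochschildComplex]

variable {R' X' Y' : Type u} [Ring R'] [Algebra k R'] [AddCommGroup X'] [Module k X']
  [AddCommGroup Y'] [Module k Y']

/-- The map `f ↦ ((a₁, …, aₙ) ↦ v ∘ f(α a₁, …, α aₙ) ∘ u)` on Hochschild cochains. -/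
def hochPush (α : R' →ₐ[k] R) (u : X' →ₗ[k] X) (v : Y →ₗ[k] Y') (n : ℕ) :
    MultilinearMap k (fun _ : Fin n => R) (X →ₗ[k] Y) →ₗ[k]
      MultilinearMap k (fun _ : Fin n => R') (X' →ₗ[k] Y') where
  toFun f := (LinearMap.lcomp k Y' u ∘ₗ LinearMap.llcomp k X Y Y' v).compMultilinearMap
    (f.compLinearMap fun _ => α.toLinearMap)
  map_add' f g := by ext; simp
  map_smul' c f := by ext; simp

@[simp] theorem hochPush_apply (α : R' →ₐ[k] R) (u : X' →ₗ[k] X) (v : Y →ₗ[k] Y') (n : ℕ)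
    (f : MultilinearMap k (fun _ : Fin n => R) (X →ₗ[k] Y)) (a : Fin n → R') (x : X') :
    hochPush α u v n f a x = v (f (fun i => α (a i)) (u x)) := rfl

theorem hochD_hochPush {ρ : R →ₐ[k] Module.End k X} {σ : R →ₐ[k] Module.End k Y}
    {ρ' : R' →ₐ[k] Module.End k X'} {σ' : R' →ₐ[k] Module.End k Y'}
    (α : R' →ₐ[k] R) (u : X' →ₗ[k] X) (v : Y →ₗ[k] Y')
    (hu : ∀ a x, u (ρ' a x) = ρ (α a) (u x)) (hv : ∀ a y, v (σ (α a) y) = σ' a (v y))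
    (n : ℕ) (f : MultilinearMap k (fun _ : Fin n => R) (X →ₗ[k] Y)) :
    hochD ρ' σ' n (hochPush α u v n f) = hochPush α u v (n + 1) (hochD ρ σ n f) := by
  ext a x
  have h (j : Fin n) : (fun i => α (Fin.contractNth j.castSucc (· * ·) a i)) =
      Fin.contractNth j.castSucc (· * ·) (fun i => α (a i)) := by
    funext i
    simp only [Fin.contractNth]
    split_ifs <;> simp
  rw [hochPush_apply, hochD_apply, hochD_apply]
  simp only [hochPush_apply, map_add, map_sum, map_zsmul, hu, hv, h]
  rfl

/-- The map of Hochschild complexes induced by an algebra homomorphism `α` and linear maps `u`, `v`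
that are compatible with it. -/
def hochschildComplexMap {ρ : R →ₐ[k] Module.End k X} {σ : R →ₐ[k] Module.End k Y}
    {ρ' : R' →ₐ[k] Module.End k X'} {σ' : R' →ₐ[k] Module.End k Y'}
    (α : R' →ₐ[k] R) (u : X' →ₗ[k] X) (v : Y →ₗ[k] Y')
    (hu : ∀ a x, u (ρ' a x) = ρ (α a) (u x)) (hv : ∀ a y, v (σ (α a) y) = σ' a (v y)) :
    hochschildComplex ρ σ ⟶ hochschildComplex ρ' σ' :=
  CochainComplex.ofHom (fun n => ModuleCat.ofHom (hochPush α u v n)) (fun n => by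
    rw [hochschildComplex_d, hochschildComplex_d]
    ext f : 2
    exact hochD_hochPush α u v hu hv n f)

end Hochschild

/-! ### Presheaves of modules and global Hochschild cohomology

Presheaves are covariant here. -/

/-- A presheaf of left modules over a presheaf `A` of associative `k`-algebras: a left
`A(c)`-module for each object `c`, given as a `k`-module together with a homomorphism of algebras
from `A(c)` to its endomorphisms, and restriction maps that are functorial and semilinear. -/
structure ModulePresheaf (A : C ⥤ AlgCat.{u} k) where
  /-- the underlying presheaf of `k`-modules -/
  toPresheaf : C ⥤ ModuleCat.{u} k
  /-- the action of `A(c)` -/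
  act (c : C) : A.obj c →ₐ[k] Module.End k (toPresheaf.obj c)
  map_act {c c' : C} (φ : c ⟶ c') (a : A.obj c) (x : toPresheaf.obj c) :
    (toPresheaf.map φ).hom (act c a x) = act c' ((A.map φ).hom a) ((toPresheaf.map φ).hom x)

variable {A : C ⥤ AlgCat.{u} k} (F G : ModulePresheaf A)

/-- The Hochschild complex of `A` with values in `Hom_k(F, G)`, as a functor on the category of
morphisms. For `φ : c ⟶ c'` it is the Hochschild complex of `A(c)` with values in the bimodule
`Hom_k(F(c), G(c'))`, where `A(c)` acts on `G(c')` through `A(φ)`. A morphism `(α, β)` acts by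
`f ↦ G(β) ∘ f(A(α) -, …, A(α) -) ∘ F(α)`. -/
def hochschildFunctor : Mor C ⥤ CochainComplex (ModuleCat.{u} k) ℕ where
  obj φ := hochschildComplex (F.act φ.src) ((G.act φ.tgt).comp (A.map φ.arrow).hom)
  map {φ ψ} t := hochschildComplexMap (A.map t.left).hom (F.toPresheaf.map t.left).hom
    (G.toPresheaf.map t.right).hom (fun a x => F.map_act t.left a x) (fun a y => by
      have h := congrArg (fun s => (A.map s).hom a) t.comm
      simp only [Functor.map_comp, AlgCat.hom_comp, AlgHom.comp_apply] at h
      simp only [AlgHom.comp_apply]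
      rw [G.map_act, h])
  map_id φ := by
    ext n f : 3
    apply MultilinearMap.ext
    intro a
    ext x
    let f' : MultilinearMap k (fun _ : Fin n => A.obj φ.src)
      (F.toPresheaf.obj φ.src →ₗ[k] G.toPresheaf.obj φ.tgt) := f
    change (G.toPresheaf.map (𝟙 _)).hom (f' (fun i => (A.map (𝟙 _)).hom (a i))
      ((F.toPresheaf.map (𝟙 _)).hom x)) = f' a x
    simp only [CategoryTheory.Functor.map_id]
    rfl
  map_comp {φ ψ χ} s t := by
    ext n f : 3
    apply MultilinearMap.ext
    intro a
    ext x
    let f' : MultilinearMap k (fun _ : Fin n => A.obj φ.src)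
      (F.toPresheaf.obj φ.src →ₗ[k] G.toPresheaf.obj φ.tgt) := f
    change (G.toPresheaf.map (s.right ≫ t.right)).hom
      (f' (fun i => (A.map (t.left ≫ s.left)).hom (a i))
        ((F.toPresheaf.map (t.left ≫ s.left)).hom x)) = _
    simp only [CategoryTheory.Functor.map_comp]
    rfl

/-- The functor `φ ↦ Ext^q_{A(c)}(F(c), G(c'))`, for `φ : c ⟶ c'`, on the category of morphisms:
the `q`-th cohomology of the Hochschild complex of `A` with values in `Hom_k(F, G)`. -/
noncomputable def extFunctor (q : ℕ) : Mor C ⥤ ModuleCat.{u} k :=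
  hochschildFunctor F G ⋙ HomologicalComplex.homologyFunctor _ _ q

/-- The total complex of a double complex `K` over `ℕ × ℕ`: its `n`-th term is the direct sum of the
`K^{pq}` with `p + q = n`, and its differential is the sum of the first differential and of
`(-1)^p` times the second one. -/
instance totalComplexShapeNat :
    TotalComplexShape (ComplexShape.up ℕ) (ComplexShape.up ℕ) (ComplexShape.up ℕ) where
  π := fun ⟨p, q⟩ => p + q
  ε₁ := fun _ => 1
  ε₂ := fun ⟨p, _⟩ => (-1) ^ p
  rel₁ := by
    rintro p _ rfl q
    change p + q + 1 = p + 1 + q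
    lia
  rel₂ := by
    rintro p q _ rfl
    rfl
  ε₂_ε₁ := by rintro p _ q _ rfl rfl; simp [pow_succ]

/-- The global Hochschild complex: the total complex of the double complex with `(p, q)`-term
`D^p(c, HC^q(A, Hom_k(F, G)))`. Its differential is the sum of the first differential and of
`(-1)^p` times the second one. -/
noncomputable def globalHochschildComplex : CochainComplex (ModuleCat.{u} k) ℕ :=
  (resolvingBicomplex (hochschildFunctor F G)).total (ComplexShape.up ℕ)

/-- The global Hochschild cohomology `HH^n(c, A, Hom_k(F, G))`. -/
noncomputable def globalHochschildCohomology (n : ℕ) : ModuleCat.{u} k :=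
  (globalHochschildComplex F G).homology n

/-! ### Spectral sequences -/

/-- The term `E_∞^{pq}` of a first quadrant spectral sequence: the term `E_r^{pq}` for
`r = max (p + 1) (q + 2)`. From this page on, all differentials that start or end in position
`(p, q)` vanish. -/
def pageInfinity (E : E₂CohomologicalSpectralSequenceNat (ModuleCat.{u} k)) (p q : ℕ) :
    ModuleCat.{u} k :=
  (E.page (max (p + 1) (q + 2)) (by lia)).X (p, q)

/-- The terms `E_r^{pq}` for `r ≥ max (p + 1) (q + 2)` are all isomorphic, by the isomorphisms that
are part of the spectral sequence. -/
theorem page_stationary (E : E₂CohomologicalSpectralSequenceNat (ModuleCat.{u} k)) (p q : ℕ)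
    (r : ℤ) (hr : max ((p : ℤ) + 1) (q + 2) ≤ r) :
    Nonempty ((E.page r (by lia)).X (p, q) ≅ pageInfinity E p q) := by
  induction r, hr using Int.leInduction with
  | base => exact ⟨Iso.refl _⟩
  | succ r hr ih =>
    obtain ⟨e⟩ := ih
    have hr2 : 2 ≤ r := by lia
    let K := E.page r hr2
    have hf : (K.sc (p, q)).f = 0 := K.shape _ _ (by
      intro h
      have h' := h.1
      dsimp only at h'
      lia)
    have hg : (K.sc (p, q)).g = 0 := K.shape _ _ (by
      intro h
      have h' := h.2
      dsimp only at h'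
      lia)
    exact ⟨(E.iso r (r + 1) (p, q)).symm ≪≫
      (ShortComplex.HomologyData.ofZeros (K.sc (p, q)) hf hg).left.homologyIso ≪≫ e⟩

end GlobalHochschild

/-! The spectral sequence is that of the total complex filtered by the first degree `p`. With
`F^p_n` the part of degree `n` in columns at least `p`, put `Z_r^p = {x ∈ F^p : dx ∈ F^{p+r}}`,
`B_r^p = Z_{r-1}^{p+1} + d Z_{r-1}^{p-r+1}` and `E_r = Z_r / B_r`. The differential induces `d_r`. A
class killed by `d_r` has a representative in `Z_{r+1}` (`exists_mem_Z_succ`), and an element of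
`Z_{r+1}` lies in `B_{r+1}` exactly if it is a `d_r`-boundary modulo `B_r` (`mem_B_succ_iff`). Hence
`H(E_r) = E_{r+1}` (`pageIso`).

In each degree the filtration is finite: it is constant for `p ≤ 0` and zero for `p > n`. For large
`r`, therefore, `Z_r` consists of the cycles in `F^p`, and `B_r` of those homologous to a cycle in
`F^{p+1}`, so that `E_r` is a graded piece of the cohomology (`filtrationQuotientEquiv`).

Taking the leading entry `z ↦ z_{pq}` identifies `E_2` with the horizontal cohomology of the
vertical cohomology (`secondPageIso`). Products of modules are exact, so the vertical cohomology of
`D^p(c, K^q)` is `D^p(c, H^q(K))`, and the horizontal differential induces that of the resolving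
complex by naturality (`cochainClass` and its lemmas). Of the Hochschild complex, only its
functoriality on `Mor C` matters.

To avoid transport along equalities `p + q = n`, all degrees live in one module, that of families `x
i j`, and the degree is recorded by submodules with integer indices. Every isomorphism arises from
two surjections out of a common module with the same kernel (`LinearMap.equivOfKerEq`). -/

/-! ### Homology of complexes of modules -/

namespace HomologicalComplex

variable {k : Type u} [Ring k] {ι : Type*} {c : ComplexShape ι}

/-- The map that sends a cycle to its class in homology. -/
noncomputable def homologyClass (K : HomologicalComplex (ModuleCat.{u} k) c) (i j : ι)
    (hj : c.next i = j) : LinearMap.ker (K.d i j).hom →ₗ[k] K.homology i :=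
  (K.liftCycles (ModuleCat.ofHom (LinearMap.ker (K.d i j).hom).subtype) j hj
    (by ext x; exact x.2) ≫ K.homologyπ i).hom

variable (K : HomologicalComplex (ModuleCat.{u} k) c)

theorem homologyπ_surjective (i : ι) : Function.Surjective (K.homologyπ i).hom :=
  (ModuleCat.epi_iff_surjective _).1 inferInstance

theorem iCycles_injective (i : ι) : Function.Injective (K.iCycles i).hom :=
  (ModuleCat.mono_iff_injective _).1 inferInstance

/-- `homologyπ` is the cokernel of `toCycles`, and exactness in modules can be read on elements.
Injectivity of `iCycles` moves the resulting equation from the cycles to `K`. -/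
theorem homologyπ_apply_eq_zero_iff {i' i : ι} (hi : c.prev i = i') (z : K.cycles i) :
    (K.homologyπ i).hom z = 0 ↔ ∃ y : K.X i', (K.d i' i).hom y = (K.iCycles i).hom z := by
  have hex : (ShortComplex.mk (K.toCycles i' i) (K.homologyπ i) (by simp)).Exact :=
    ShortComplex.exact_of_g_is_cokernel _ (K.homologyIsCokernel i' i hi)
  have h (y : K.X i') : (K.iCycles i).hom ((K.toCycles i' i).hom y) = (K.d i' i).hom y := by
    rw [← K.toCycles_i i' i]; rfl
  constructor
  · intro hz
    obtain ⟨y, hy⟩ := (ShortComplex.moduleCat_exact_iff _).1 hex z hz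
    refine ⟨y, ?_⟩
    rw [← h]
    exact congrArg _ hy
  · rintro ⟨y, hy⟩
    rw [← h] at hy
    rw [← K.iCycles_injective i hy]
    exact congrArg (fun t => t.hom y) (K.toCycles_comp_homologyπ i' i)

theorem exists_cycle {i j : ι} (hj : c.next i = j) (x : K.X i) (hx : (K.d i j).hom x = 0) :
    ∃ z : K.cycles i, (K.iCycles i).hom z = x :=
  ⟨(K.liftCycles (ModuleCat.ofHom (LinearMap.ker (K.d i j).hom).subtype) j hj
    (by ext x; exact x.2)).hom ⟨x, hx⟩, congrArg (fun t => t.hom ⟨x, hx⟩)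
      (K.liftCycles_i (ModuleCat.ofHom (LinearMap.ker (K.d i j).hom).subtype) j hj _)⟩

theorem d_iCycles_apply (i j : ι) (z : K.cycles i) : (K.d i j).hom ((K.iCycles i).hom z) = 0 :=
  congrArg (fun t => t.hom z) (K.iCycles_d i j)

/-- Links cycles as elements of a kernel with the abstract object `cycles`: since `iCycles` is
injective, the lift of `x` is determined by its image. -/
theorem homologyClass_eq {i j : ι} (hj : c.next i = j) (z : K.cycles i)
    (x : LinearMap.ker (K.d i j).hom) (h : (K.iCycles i).hom z = x) :
    K.homologyClass i j hj x = (K.homologyπ i).hom z := by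
  have : (K.liftCycles (ModuleCat.ofHom (LinearMap.ker (K.d i j).hom).subtype) j hj
      (by ext x; exact x.2)).hom x = z := by
    apply K.iCycles_injective i
    rw [h]
    exact congrArg (fun t => t.hom x)
      (K.liftCycles_i (ModuleCat.ofHom (LinearMap.ker (K.d i j).hom).subtype) j hj _)
  rw [← this]
  rfl

theorem homologyClass_surjective (i j : ι) (hj : c.next i = j) :
    Function.Surjective (K.homologyClass i j hj) := by
  intro h
  obtain ⟨z, rfl⟩ := K.homologyπ_surjective i h
  exact ⟨⟨_, K.d_iCycles_apply i j z⟩, K.homologyClass_eq hj z _ rfl⟩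

theorem homologyClass_eq_zero_iff {i' i j : ι} (hi : c.prev i = i') (hj : c.next i = j)
    (x : LinearMap.ker (K.d i j).hom) :
    K.homologyClass i j hj x = 0 ↔ ∃ y : K.X i', (K.d i' i).hom y = x := by
  obtain ⟨z, hz⟩ := K.exists_cycle hj x x.2
  rw [K.homologyClass_eq hj z x hz, K.homologyπ_apply_eq_zero_iff hi, hz]

end HomologicalComplex

/-- Two modules that are images of the same module under maps with the same kernel are
isomorphic. -/
noncomputable def LinearMap.equivOfKerEq {k N X Y : Type*} [Ring k] [AddCommGroup N]
    [AddCommGroup X] [AddCommGroup Y] [Module k N] [Module k X] [Module k Y]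
    (f : N →ₗ[k] X) (g : N →ₗ[k] Y) (hf : Function.Surjective f) (hg : Function.Surjective g)
    (h : ∀ n, f n = 0 ↔ g n = 0) : X ≃ₗ[k] Y :=
  (f.quotKerEquivOfSurjective hf).symm ≪≫ₗ
    Submodule.quotEquivOfEq _ _ (by ext n; exact h n) ≪≫ₗ g.quotKerEquivOfSurjective hg

/-- A description of the homology of a complex of modules: if `ψ : N → K_i` takes its values in the
cycles and meets all homology classes, then homology is the image of `N` under every map whose
kernel consists of the elements that `ψ` sends to boundaries. -/
noncomputable def HomologicalComplex.homologyIsoOf {k : Type u} [Ring k] {ι : Type*}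
    {c : ComplexShape ι} (K : HomologicalComplex (ModuleCat.{u} k) c) {i' i j : ι}
    (hi : c.prev i = i') (hj : c.next i = j) {N : Type u} [AddCommGroup N] [Module k N]
    {H : ModuleCat.{u} k} (ψ : N →ₗ[k] K.X i) (χ : N →ₗ[k] H) (hχ : Function.Surjective χ)
    (hψ : ∀ n, (K.d i j).hom (ψ n) = 0)
    (hs : ∀ x : K.X i, (K.d i j).hom x = 0 → ∃ n, ψ n = x)
    (h : ∀ n, χ n = 0 ↔ ∃ y : K.X i', (K.d i' i).hom y = ψ n) : K.homology i ≅ H :=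
  (LinearMap.equivOfKerEq (K.homologyClass i j hj ∘ₗ ψ.codRestrict _ hψ) χ
    (fun x => by
      obtain ⟨⟨z, hz⟩, rfl⟩ := K.homologyClass_surjective i j hj x
      obtain ⟨n, rfl⟩ := hs z hz
      exact ⟨n, rfl⟩) hχ
    (fun n => by
      rw [h]
      exact K.homologyClass_eq_zero_iff hi hj _)).toModuleIso

/-! ### The spectral sequence of a filtered differential module -/

/-- A module with a differential and a family of submodules `F^p_n`, where `n` is a cohomological
degree and `p` is the index of a decreasing filtration that is concentrated in `0 ≤ p ≤ n`. -/
structure FilteredDifferential (k M : Type u) [Ring k] [AddCommGroup M] [Module k M] where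
  /-- the differential -/
  d : M →ₗ[k] M
  /-- the filtration -/
  F : ℤ → ℤ → Submodule k M
  d_d (x : M) : d (d x) = 0
  anti {p p' : ℤ} (n : ℤ) (h : p ≤ p') : F p' n ≤ F p n
  d_mem {p n : ℤ} {x : M} (hx : x ∈ F p n) : d x ∈ F p (n + 1)
  F_of_nonpos {p : ℤ} (n : ℤ) (hp : p ≤ 0) : F p n = F 0 n
  F_of_lt {p n : ℤ} (h : n < p) : F p n = ⊥

namespace FilteredDifferential

variable {k M : Type u} [Ring k] [AddCommGroup M] [Module k M] (S : FilteredDifferential k M)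

/-- The elements of `F^p_n` whose differential lies in `F^{p+r}_{n+1}`. -/
def Z (r p n : ℤ) : Submodule k M := S.F p n ⊓ (S.F (p + r) (n + 1)).comap S.d

/-- The submodule by which `Z_r^p` is divided to obtain the `r`-th page. -/
def B (r p n : ℤ) : Submodule k M :=
  S.Z (r - 1) (p + 1) n ⊔ (S.Z (r - 1) (p - r + 1) (n - 1)).map S.d

/-- The terms of the `r`-th page. -/
abbrev E (r p n : ℤ) : Type u := S.Z r p n ⧸ (S.B r p n).submoduleOf (S.Z r p n)

variable {S}

theorem mem_Z {r p n : ℤ} {x : M} : x ∈ S.Z r p n ↔ x ∈ S.F p n ∧ S.d x ∈ S.F (p + r) (n + 1) :=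
  Iff.rfl

theorem mem_B {r p n : ℤ} {x : M} : x ∈ S.B r p n ↔
    ∃ a ∈ S.Z (r - 1) (p + 1) n, ∃ b ∈ S.Z (r - 1) (p - r + 1) (n - 1), a + S.d b = x := by
  simp [B, Submodule.mem_sup]

theorem eq_zero_of_mem_F {p n : ℤ} {x : M} (hx : x ∈ S.F p n) (h : n < p) : x = 0 := by
  rwa [S.F_of_lt h] at hx

theorem F_le_of_nonpos {p p' n : ℤ} (hp' : p' ≤ 0) : S.F p n ≤ S.F p' n := by
  rw [S.F_of_nonpos n hp']
  rcases le_total p 0 with h | h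
  · rw [S.F_of_nonpos n h]
  · exact S.anti n h

theorem d_mem_Z {r p n p' n' : ℤ} (hp : p + r = p') (hn : n + 1 = n') {x : M}
    (hx : x ∈ S.Z r p n) (s : ℤ) : S.d x ∈ S.Z s p' n' := by
  subst hp hn
  refine ⟨hx.2, ?_⟩
  rw [SetLike.mem_coe, Submodule.mem_comap, S.d_d]
  exact zero_mem _

theorem d_mem_B {r p n p' n' : ℤ} (hp : p + r = p') (hn : n + 1 = n') {x : M}
    (hx : x ∈ S.B r p n) : S.d x ∈ S.B r p' n' := by
  obtain ⟨a, ha, b, hb, rfl⟩ := mem_B.1 hx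
  -- The summand `d b` dies, and `a` lies in the very module whose image under `d` is divided out at
  -- `p' = p + r`.
  refine mem_B.2 ⟨0, zero_mem _, a, ?_, by simp [S.d_d]⟩
  rwa [show p' - r + 1 = p + 1 by lia, show n' - 1 = n by lia]

variable (S)

/-- The differential of the `r`-th page. -/
def pageD {r p n p' n' : ℤ} (hp : p + r = p') (hn : n + 1 = n') : S.E r p n →ₗ[k] S.E r p' n' :=
  Submodule.mapQ _ _ (S.d.restrict fun _ hx => d_mem_Z hp hn hx r) fun _ hx => d_mem_B hp hn hx

variable {S}

theorem mk_eq_zero_iff {r p n : ℤ} (z : S.Z r p n) :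
    ((S.B r p n).submoduleOf (S.Z r p n)).mkQ z = 0 ↔ (z : M) ∈ S.B r p n := by
  rw [Submodule.mkQ_apply, Submodule.Quotient.mk_eq_zero]; rfl

theorem pageD_mk {r p n p' n' : ℤ} (hp : p + r = p') (hn : n + 1 = n') (z : S.Z r p n) :
    S.pageD hp hn (((S.B r p n).submoduleOf (S.Z r p n)).mkQ z) =
      ((S.B r p' n').submoduleOf (S.Z r p' n')).mkQ ⟨S.d z, d_mem_Z hp hn z.2 r⟩ := rfl

theorem pageD_pageD {r p n p' n' p'' n'' : ℤ} (hp : p + r = p') (hn : n + 1 = n')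
    (hp' : p' + r = p'') (hn' : n' + 1 = n'') :
    S.pageD hp' hn' ∘ₗ S.pageD hp hn = 0 := by
  ext z
  change S.pageD hp' hn' (S.pageD hp hn (Submodule.mkQ _ z)) = 0
  rw [pageD_mk, pageD_mk, mk_eq_zero_iff]
  simp [S.d_d]

theorem mk_eq_mk_iff {r p n : ℤ} (z z' : S.Z r p n) :
    ((S.B r p n).submoduleOf (S.Z r p n)).mkQ z =
      ((S.B r p n).submoduleOf (S.Z r p n)).mkQ z' ↔ (z - z' : M) ∈ S.B r p n := by
  rw [← sub_eq_zero, ← map_sub, mk_eq_zero_iff]; rfl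

theorem Z_succ_le (r p n : ℤ) : S.Z (r + 1) p n ≤ S.Z r p n := fun _ hx =>
  ⟨hx.1, S.anti _ (by lia) hx.2⟩

theorem mem_Z_of_d_eq_zero {r p n : ℤ} {x : M} (hx : x ∈ S.F p n) (h : S.d x = 0) :
    x ∈ S.Z r p n := mem_Z.2 ⟨hx, h ▸ zero_mem _⟩

/-- Here `F^{p+r}_{n+1} = 0`, so every element of `Z_r` is already a cycle. This covers positions
whose outgoing differential leaves the quadrant. -/
theorem Z_succ_eq {r p n : ℤ} (h : n + 1 < p + r) : S.Z r p n ≤ S.Z (r + 1) p n := fun _ hx =>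
  mem_Z_of_d_eq_zero hx.1 (eq_zero_of_mem_F hx.2 h)

/-- The filtration is constant in indices `≤ 0`, so raising the index costs nothing there, and the
target index `p + r = p' + (r - 1)` is unchanged. -/
theorem mem_Z_pred_of_neg {r p p' n : ℤ} {x : M} (hx : x ∈ S.Z r p n) (hp : p + 1 = p')
    (hp' : p' ≤ 0) :
    x ∈ S.Z (r - 1) p' n :=
  ⟨F_le_of_nonpos hp' hx.1, by rw [show p' + (r - 1) = p + r by lia]; exact hx.2⟩

theorem mem_Z_of_mem_pred {r p p' n : ℤ} {x : M} (hx : x ∈ S.Z (r - 1) p' n) (hp : p + 1 = p') :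
    x ∈ S.Z r p n :=
  ⟨S.anti n (by lia) hx.1, by rw [show p + r = p' + (r - 1) by lia]; exact hx.2⟩

/-! ### Passing from one page to the next. -/

/-- A cycle of the `r`-th page is represented by an element of `Z_{r+1}`. -/
theorem exists_mem_Z_succ {r p n p' n' : ℤ} (hp : p + r = p') (hn : n + 1 = n') {z : M}
    (hz : z ∈ S.Z r p n) (hd : S.d z ∈ S.B r p' n') :
    ∃ w ∈ S.Z (r + 1) p n, z - w ∈ S.B r p n := by
  subst hp hn
  obtain ⟨a, ha, b, hb, h⟩ := mem_B.1 hd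
  rw [show p + r - r + 1 = p + 1 by lia, show n + 1 - 1 = n by lia] at hb
  -- From `d z = a + d b`, the corrected element `z - b` has differential `a`, which lies one
  -- filtration step deeper; `b` itself is in `B_r`.
  refine ⟨z - b, ⟨sub_mem hz.1 (S.anti n (by lia) hb.1), ?_⟩,
    mem_B.2 ⟨b, hb, 0, zero_mem _, by simp⟩⟩
  rw [SetLike.mem_coe, Submodule.mem_comap, map_sub, ← h, add_sub_cancel_right]
  rw [show p + (r + 1) = p + r + 1 by lia]
  exact ha.1

/-- The boundaries of the `r`-th page among the elements of `Z_{r+1}`. -/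
theorem mem_B_succ_iff {r p n p' n' : ℤ} (hp : p' + r = p) (hn : n' + 1 = n) {z : M}
    (hz : z ∈ S.Z (r + 1) p n) :
    z ∈ S.B (r + 1) p n ↔ ∃ y ∈ S.Z r p' n', S.d y - z ∈ S.B r p n := by
  obtain rfl : p' = p - r := by lia
  obtain rfl : n' = n - 1 := by lia
  rw [mem_B, show r + 1 - 1 = r by lia, show p - (r + 1) + 1 = p - r by lia]
  constructor
  · rintro ⟨a, ha, b, hb, rfl⟩
    refine ⟨b, hb, mem_B.2 ⟨-a, neg_mem ?_, 0, zero_mem _, by simp⟩⟩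
    exact Z_succ_le (r - 1) (p + 1) n (by rwa [show r - 1 + 1 = r by lia])
  · rintro ⟨y, hy, h⟩
    obtain ⟨a, ha, b, hb, h⟩ := mem_B.1 h
    have hb' : b ∈ S.Z r (p - r) (n - 1) := mem_Z_of_mem_pred hb rfl
    have hz' : z = -a + S.d (y - b) := by
      rw [map_sub, ← sub_eq_zero, ← sub_eq_zero.2 h]; abel
    -- The element `a` is only known to be in `Z_{r-1}`; as `-a` differs from `z ∈ Z_{r+1}` by a
    -- boundary, its differential inherits the stronger bound.
    have hd : S.d (-a) = S.d z := by rw [hz', map_add, S.d_d, add_zero]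
    refine ⟨-a, mem_Z.2 ⟨Submodule.neg_mem _ ha.1, ?_⟩, y - b, Submodule.sub_mem _ hy hb', hz'.symm⟩
    rw [hd, show p + 1 + r = p + (r + 1) by lia]
    exact hz.2

/-- The condition on the differential of `a = z - d b` can be dropped: `d a = d z` is in `F^{p+2}`
already. -/
theorem mem_B_two_iff {p n : ℤ} {z : M} (hz : z ∈ S.Z 2 p n) :
    z ∈ S.B 2 p n ↔
      ∃ b ∈ S.F (p - 1) (n - 1), S.d b ∈ S.F p n ∧ z - S.d b ∈ S.F (p + 1) n := by
  rw [mem_B]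
  constructor
  · rintro ⟨a, ha, b, hb, rfl⟩
    rw [show p - 2 + 1 = p - 1 by lia] at hb
    have hb' := hb.2
    rw [show p - 1 + (2 - 1) = p by lia, show n - 1 + 1 = n by lia] at hb'
    exact ⟨b, hb.1, hb', by rw [add_sub_cancel_right]; exact ha.1⟩
  · rintro ⟨b, hb, hbd, hzb⟩
    refine ⟨_, mem_Z.2 ⟨hzb, ?_⟩, b, mem_Z.2 ⟨?_, ?_⟩, sub_add_cancel _ _⟩
    · rw [map_sub, S.d_d, sub_zero, show p + 1 + (2 - 1) = p + 2 by lia]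
      exact hz.2
    · rwa [show p - 2 + 1 = p - 1 by lia]
    · rwa [show p - 2 + 1 + (2 - 1) = p by lia, show n - 1 + 1 = n by lia]

/-- The source of the incoming `d_r` has index `p - r < 0`. There the filtration is constant, so its
elements also lie in `Z_{r-1}^{p-r+1}` and their boundaries are in `B_r` already. -/
theorem B_succ_iff_of_lt {r p n : ℤ} (hp : p < r) {z : M} (hz : z ∈ S.Z (r + 1) p n) :
    z ∈ S.B (r + 1) p n ↔ z ∈ S.B r p n := by
  rw [mem_B_succ_iff (p' := p - r) (n' := n - 1) (by lia) (by lia) hz]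
  constructor
  · rintro ⟨y, hy, h⟩
    rw [← neg_mem_iff, neg_sub] at h
    rw [← sub_add_cancel z (S.d y)]
    refine add_mem h (mem_B.2 ⟨0, zero_mem _, y, mem_Z_pred_of_neg hy rfl (by lia), by simp⟩)
  · intro h
    exact ⟨0, zero_mem _, by simpa using h⟩

/-- The quotient map from `Z_{r+1}` to the terms of the `r`-th page. -/
abbrev mkSucc (S : FilteredDifferential k M) (r p n : ℤ) : S.Z (r + 1) p n →ₗ[k] S.E r p n :=
  ((S.B r p n).submoduleOf (S.Z r p n)).mkQ ∘ₗ Submodule.inclusion (Z_succ_le r p n)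

theorem mkSucc_eq_zero_iff {r p n : ℤ} (z : S.Z (r + 1) p n) :
    S.mkSucc r p n z = 0 ↔ (z : M) ∈ S.B r p n :=
  mk_eq_zero_iff (Submodule.inclusion (Z_succ_le r p n) z)

theorem pageD_mkSucc {r p n p' n' : ℤ} (hp : p + r = p') (hn : n + 1 = n') (z : S.Z (r + 1) p n) :
    S.pageD hp hn (S.mkSucc r p n z) = 0 := by
  refine (mk_eq_zero_iff _).2 (mem_B.2 ⟨S.d z, ?_, 0, zero_mem _, by simp⟩)
  exact d_mem_Z (r := r + 1) (by lia) hn z.2 _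

theorem exists_mkSucc_eq {r p n p' n' : ℤ} (hp : p + r = p') (hn : n + 1 = n') (x : S.E r p n)
    (hx : S.pageD hp hn x = 0) : ∃ z, S.mkSucc r p n z = x := by
  obtain ⟨z, rfl⟩ := Submodule.mkQ_surjective _ x
  rw [pageD_mk, mk_eq_zero_iff] at hx
  obtain ⟨w, hw, hzw⟩ := exists_mem_Z_succ hp hn z.2 hx
  exact ⟨⟨w, hw⟩, ((mk_eq_mk_iff z (Submodule.inclusion (Z_succ_le r p n) ⟨w, hw⟩)).2 hzw).symm⟩

theorem exists_mkSucc_eq_of_lt {r p n : ℤ} (h : n + 1 < p + r) (x : S.E r p n) :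
    ∃ z, S.mkSucc r p n z = x := by
  obtain ⟨z, rfl⟩ := Submodule.mkQ_surjective _ x
  exact ⟨⟨z, Z_succ_eq h z.2⟩, rfl⟩

theorem exists_pageD_eq_iff {r p n p' n' : ℤ} (hp : p' + r = p) (hn : n' + 1 = n)
    (z : S.Z (r + 1) p n) :
    (z : M) ∈ S.B (r + 1) p n ↔ ∃ y, S.pageD hp hn y = S.mkSucc r p n z := by
  rw [mem_B_succ_iff hp hn z.2]
  constructor
  · rintro ⟨y, hy, hyz⟩
    refine ⟨Submodule.mkQ _ ⟨y, hy⟩, ?_⟩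
    rw [pageD_mk]
    exact (mk_eq_mk_iff _ (Submodule.inclusion (Z_succ_le r p n) z)).2 hyz
  · rintro ⟨y, hyz⟩
    obtain ⟨y, rfl⟩ := Submodule.mkQ_surjective _ y
    rw [pageD_mk] at hyz
    exact ⟨y, y.2, (mk_eq_mk_iff _ (Submodule.inclusion (Z_succ_le r p n) z)).1 hyz⟩

variable (S)

theorem degree_of_rel {r : ℤ} {pq pq' : ℕ × ℕ}
    (h : (ComplexShape.spectralSequenceNat ⟨r, 1 - r⟩).Rel pq pq') :
    (pq.1 + pq.2 + 1 : ℤ) = pq'.1 + pq'.2 := by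
  have h₁ := h.1
  have h₂ := h.2
  dsimp only at h₁ h₂
  lia

open Classical in
/-- The `r`-th page. -/
noncomputable def page (r : ℤ) :
    HomologicalComplex (ModuleCat.{u} k) (ComplexShape.spectralSequenceNat ⟨r, 1 - r⟩) where
  X pq := ModuleCat.of k (S.E r pq.1 (pq.1 + pq.2))
  d pq pq' :=
    if h : (ComplexShape.spectralSequenceNat ⟨r, 1 - r⟩).Rel pq pq' then
      ModuleCat.ofHom (S.pageD h.1 (degree_of_rel h))
    else 0
  shape _ _ h := dif_neg h
  d_comp_d' pq pq' pq'' h h' := by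
    rw [dif_pos h, dif_pos h']
    rw [← ModuleCat.ofHom_comp, pageD_pageD]
    rfl

theorem page_d {r : ℤ} {pq pq' : ℕ × ℕ}
    (h : (ComplexShape.spectralSequenceNat ⟨r, 1 - r⟩).Rel pq pq') :
    (S.page r).d pq pq' = ModuleCat.ofHom (S.pageD (r := r) (n := pq.1 + pq.2) (n' := pq'.1 + pq'.2)
      h.1 (degree_of_rel h)) :=
  dif_pos h

/-- `next` defaults to the position itself, so the failure of the relation means that the target `(p
+ r, q + 1 - r)` is outside the quadrant, that is `q + 1 - r < 0`. -/
theorem lt_of_not_rel_next {r : ℤ} (hr : 0 ≤ r) {pq : ℕ × ℕ}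
    (h : ¬ (ComplexShape.spectralSequenceNat ⟨r, 1 - r⟩).Rel pq
      ((ComplexShape.spectralSequenceNat ⟨r, 1 - r⟩).next pq)) : (pq.2 : ℤ) + 1 < r := by
  by_contra! h'
  have hrel : (ComplexShape.spectralSequenceNat ⟨r, 1 - r⟩).Rel pq
      (pq.1 + r.toNat, (pq.2 + 1 - r).toNat) := by
    constructor <;> dsimp only <;> push_cast <;> lia
  rw [(ComplexShape.spectralSequenceNat _).next_eq' hrel] at h
  exact h hrel

theorem lt_of_not_rel_prev {r : ℤ} (hr : 1 ≤ r) {pq : ℕ × ℕ}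
    (h : ¬ (ComplexShape.spectralSequenceNat ⟨r, 1 - r⟩).Rel
      ((ComplexShape.spectralSequenceNat ⟨r, 1 - r⟩).prev pq) pq) : (pq.1 : ℤ) < r := by
  by_contra! h'
  have hrel : (ComplexShape.spectralSequenceNat ⟨r, 1 - r⟩).Rel
      ((pq.1 - r).toNat, (pq.2 + r - 1).toNat) pq := by
    constructor <;> dsimp only <;> lia
  rw [(ComplexShape.spectralSequenceNat _).prev_eq' hrel] at h
  exact h hrel

/-- The homology of the `r`-th page is the `(r+1)`-st page. -/
noncomputable def pageIso {r : ℤ} (hr : 1 ≤ r) (pq : ℕ × ℕ) :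
    (S.page r).homology pq ≅ (S.page (r + 1)).X pq := by
  -- The common source is `Z_{r+1}`: it maps onto the cycles of `E_r` and onto `E_{r+1}`. In each
  -- goal below, the second case is that of a differential that leaves or enters the quadrant.
  refine (S.page r).homologyIsoOf rfl rfl (N := S.Z (r + 1) pq.1 (pq.1 + pq.2))
    (S.mkSucc r pq.1 (pq.1 + pq.2))
    ((S.B (r + 1) pq.1 (pq.1 + pq.2)).submoduleOf (S.Z (r + 1) pq.1 (pq.1 + pq.2))).mkQ
    (Submodule.mkQ_surjective _) ?_ ?_ ?_
  · intro z
    by_cases h : (ComplexShape.spectralSequenceNat ⟨r, 1 - r⟩).Rel pq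
      ((ComplexShape.spectralSequenceNat ⟨r, 1 - r⟩).next pq)
    · rw [S.page_d h]
      exact pageD_mkSucc h.1 (degree_of_rel h) z
    · rw [(S.page r).shape _ _ h]
      rfl
  · intro x hx
    by_cases h : (ComplexShape.spectralSequenceNat ⟨r, 1 - r⟩).Rel pq
      ((ComplexShape.spectralSequenceNat ⟨r, 1 - r⟩).next pq)
    · rw [S.page_d h] at hx
      exact exists_mkSucc_eq h.1 (degree_of_rel h) x hx
    · have hlt := lt_of_not_rel_next (by lia) h
      exact exists_mkSucc_eq_of_lt (by lia) x
  · intro z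
    refine (mk_eq_zero_iff z).trans ?_
    by_cases h : (ComplexShape.spectralSequenceNat ⟨r, 1 - r⟩).Rel
      ((ComplexShape.spectralSequenceNat ⟨r, 1 - r⟩).prev pq) pq
    · rw [S.page_d h]
      exact exists_pageD_eq_iff h.1 (degree_of_rel h) z
    · rw [(S.page r).shape _ _ h, B_succ_iff_of_lt (lt_of_not_rel_prev hr h) z.2]
      refine (mkSucc_eq_zero_iff z).symm.trans ?_
      exact ⟨fun h => ⟨0, h.symm⟩, fun ⟨_, h⟩ => h.symm⟩

/-- The spectral sequence of a filtered differential module. -/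
noncomputable def spectralSequence : E₂CohomologicalSpectralSequenceNat (ModuleCat.{u} k) where
  page r _ := S.page r
  -- The index `r'` equals `r + 1` only propositionally, hence the `eqToIso`.
  iso r r' pq h hr := S.pageIso (by lia) pq ≪≫ eqToIso (by subst h; rfl)

theorem mem_Z_iff_of_lt {r p n : ℤ} (h : n + 1 < p + r) {x : M} :
    x ∈ S.Z r p n ↔ x ∈ S.F p n ∧ S.d x = 0 :=
  ⟨fun hx => ⟨hx.1, eq_zero_of_mem_F hx.2 h⟩, fun hx => mem_Z_of_d_eq_zero hx.1 hx.2⟩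

/-- The first bound makes `a` a cycle. The second gives `p - r + 1 ≤ 0`, so `b` is an arbitrary
element of degree `n - 1`; that `d b` lies in `F^p` follows from `d b = x - a`. -/
theorem mem_B_iff_of_lt {r p n : ℤ} (h : n + 1 < p + r) (h' : p + 1 ≤ r) {x : M}
    (hx : x ∈ S.Z r p n) :
    x ∈ S.B r p n ↔ ∃ a ∈ S.F (p + 1) n, ∃ b ∈ S.F 0 (n - 1), S.d a = 0 ∧ a + S.d b = x := by
  rw [mem_B]
  constructor
  · rintro ⟨a, ha, b, hb, rfl⟩
    have ha' := (S.mem_Z_iff_of_lt (by lia)).1 ha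
    exact ⟨a, ha'.1, b, F_le_of_nonpos le_rfl hb.1, ha'.2, rfl⟩
  · rintro ⟨a, ha, b, hb, had, rfl⟩
    refine ⟨a, mem_Z_of_d_eq_zero ha had, b, ⟨F_le_of_nonpos (by lia) hb, ?_⟩, rfl⟩
    rw [SetLike.mem_coe, Submodule.mem_comap, ← add_sub_cancel_left a (S.d b),
      show p - r + 1 + (r - 1) = p by lia, show n - 1 + 1 = n by lia]
    exact sub_mem hx.1 (S.anti n (by lia) ha)

end FilteredDifferential

/-! ### The filtered differential module of a double complex -/

namespace HomologicalComplex₂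

variable {k : Type u} [Ring k]
  (K : HomologicalComplex₂ (ModuleCat.{u} k) (ComplexShape.up ℕ) (ComplexShape.up ℕ))

theorem d_d_apply (i i' i'' j : ℕ) (x : (K.X i).X j) :
    ((K.d i' i'').f j).hom (((K.d i i').f j).hom x) = 0 :=
  congrArg (fun t => t.hom x) (K.d_f_comp_d_f i i' i'' j)

theorem d_comm_apply (i i' j j' : ℕ) (x : (K.X i).X j) :
    ((K.d i i').f j').hom (((K.X i).d j j').hom x) =
      ((K.X i').d j j').hom (((K.d i i').f j).hom x) :=
  congrArg (fun t => t.hom x) ((K.d i i').comm j j').symm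

theorem X_d_d_apply (i j j' j'' : ℕ) (x : (K.X i).X j) :
    ((K.X i).d j' j'').hom (((K.X i).d j j').hom x) = 0 :=
  congrArg (fun t => t.hom x) ((K.X i).d_comp_d j j' j'')

/-- By truncation `0 - 1 = 0`, and a differential from degree `0` to itself vanishes. Thus `familyD`
can use `i - 1` and `j - 1` without a case distinction at the border. -/
theorem X_d_pred_zero_apply (i : ℕ) (x : (K.X i).X (0 - 1)) :
    ((K.X i).d (0 - 1) 0).hom x = 0 :=
  congrArg (fun t => t.hom x) ((K.X i).shape (0 - 1) 0 (by simp))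

theorem d_pred_zero_apply (j : ℕ) (x : (K.X (0 - 1)).X j) : ((K.d (0 - 1) 0).f j).hom x = 0 :=
  congrArg (fun t => (t.f j).hom x) (K.shape (0 - 1) 0 (by simp))

/-- The total differential on families of elements of the terms of a double complex. -/
noncomputable def familyD : (∀ i j, (K.X i).X j) →ₗ[k] ∀ i j, (K.X i).X j where
  toFun x i j := ((K.d (i - 1) i).f j).hom (x (i - 1) j) +
    (-1 : ℤ) ^ i • ((K.X i).d (j - 1) j).hom (x i (j - 1))
  map_add' x y := by
    funext i j
    simp only [Pi.add_apply, map_add, smul_add]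
    abel
  map_smul' a x := by
    funext i j
    simp only [Pi.smul_apply, map_smul, RingHom.id_apply, smul_add]
    rw [smul_comm]

theorem familyD_apply (x : ∀ i j, (K.X i).X j) (i j : ℕ) :
    K.familyD x i j = ((K.d (i - 1) i).f j).hom (x (i - 1) j) +
      (-1 : ℤ) ^ i • ((K.X i).d (j - 1) j).hom (x i (j - 1)) := rfl

theorem familyD_familyD (x : ∀ i j, (K.X i).X j) : K.familyD (K.familyD x) = 0 := by
  funext i j
  simp only [familyD_apply, map_add, map_zsmul, d_d_apply, X_d_d_apply, smul_zero, add_zero,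
    zero_add]
  rw [d_comm_apply, ← add_smul]
  -- The mixed terms carry the signs `(-1)^(i-1)` and `(-1)^i` and cancel. For `i = 0` truncation
  -- makes the signs equal, but the horizontal differential into column `0` is zero.
  cases i with
  | zero => rw [d_pred_zero_apply, map_zero, smul_zero]; rfl
  | succ i => rw [Nat.add_sub_cancel, pow_succ, mul_neg_one, add_neg_cancel, zero_smul]; rfl

/-- The families that are concentrated in total degree `n` and in first degrees `≥ p`. -/
def familyF (p n : ℤ) : Submodule k (∀ i j, (K.X i).X j) where
  carrier := {x | ∀ i j : ℕ, ¬ (p ≤ i ∧ (i + j : ℤ) = n) → x i j = 0}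
  add_mem' hx hy i j h := by simp [hx i j h, hy i j h]
  zero_mem' _ _ _ := rfl
  smul_mem' a x hx i j h := by simp [hx i j h]

theorem mem_familyF {p n : ℤ} {x : ∀ i j, (K.X i).X j} :
    x ∈ K.familyF p n ↔ ∀ i j : ℕ, ¬ (p ≤ i ∧ (i + j : ℤ) = n) → x i j = 0 := Iff.rfl

/-- The filtered differential module of a double complex. -/
noncomputable def filteredDifferential : FilteredDifferential k (∀ i j, (K.X i).X j) where
  d := K.familyD
  F := K.familyF
  d_d := K.familyD_familyD
  anti n h x hx i j hij := hx i j (by lia)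
  d_mem {p n x} hx i j hij := by
    rw [familyD_apply]
    have h₁ : ((K.d (i - 1) i).f j).hom (x (i - 1) j) = 0 := by
      cases i with
      | zero => exact K.d_pred_zero_apply _ _
      | succ i => rw [hx _ _ (by push_cast at *; lia), map_zero]
    have h₂ : ((K.X i).d (j - 1) j).hom (x i (j - 1)) = 0 := by
      cases j with
      | zero => exact K.X_d_pred_zero_apply _ _
      | succ j => rw [hx _ _ (by push_cast at *; lia), map_zero]
    rw [h₁, h₂, smul_zero, add_zero]
  F_of_nonpos n hp := by
    ext x
    simp only [mem_familyF]
    refine forall₂_congr fun i j => ?_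
    rw [show (_ ≤ (i : ℤ)) ↔ (0 : ℤ) ≤ i by lia]
  F_of_lt {p n} h := by
    rw [eq_bot_iff]
    intro x hx
    rw [Submodule.mem_bot]
    funext i j
    exact hx i j (by lia)

/-- The family with one given entry. -/
noncomputable def single (p q : ℕ) : (K.X p).X q →ₗ[k] ∀ i j, (K.X i).X j :=
  LinearMap.single k (fun i => ∀ j, (K.X i).X j) p ∘ₗ LinearMap.single k (fun j => (K.X p).X j) q

theorem single_same (p q : ℕ) (x : (K.X p).X q) : K.single p q x p q = x := by
  simp [single]

theorem single_of_ne {p q i j : ℕ} (h : ¬ (i = p ∧ j = q)) (x : (K.X p).X q) :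
    K.single p q x i j = 0 := by
  simp only [single, LinearMap.comp_apply, LinearMap.single_apply]
  by_cases hi : i = p
  · subst hi
    rw [Pi.single_eq_same, Pi.single_eq_of_ne (by tauto)]
  · rw [Pi.single_eq_of_ne hi]
    rfl

theorem familyD_single (p q : ℕ) (x : (K.X p).X q) :
    K.familyD (K.single p q x) = K.single (p + 1) q (((K.d p (p + 1)).f q).hom x) +
      (-1 : ℤ) ^ p • K.single p (q + 1) (((K.X p).d q (q + 1)).hom x) := by
  funext i j
  rw [familyD_apply]
  simp only [Pi.add_apply, Pi.smul_apply]
  congr 1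
  · by_cases h : i = p + 1 ∧ j = q
    · obtain ⟨rfl, rfl⟩ := h
      rw [single_same]
      exact congrArg _ (K.single_same p j x)
    · rw [K.single_of_ne h]
      cases i with
      | zero => exact K.d_pred_zero_apply _ _
      | succ i => rw [K.single_of_ne (by simp at *; tauto), map_zero]
  · by_cases h : i = p ∧ j = q + 1
    · obtain ⟨rfl, rfl⟩ := h
      rw [single_same]
      exact congrArg (fun t => (-1 : ℤ) ^ i • ((K.X i).d q (q + 1)).hom t) (K.single_same i q x)
    · rw [K.single_of_ne h]
      have : ((K.X i).d (j - 1) j).hom (K.single p q x i (j - 1)) = 0 := by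
        cases j with
        | zero => exact K.X_d_pred_zero_apply _ _
        | succ j => rw [K.single_of_ne (by simp at *; tauto), map_zero]
      rw [this, smul_zero, smul_zero]

end HomologicalComplex₂

/-! ### The cohomology of the total complex -/

namespace HomologicalComplex₂

variable {k : Type u} [Ring k]
  (K : HomologicalComplex₂ (ModuleCat.{u} k) (ComplexShape.up ℕ) (ComplexShape.up ℕ))

/-- The components of an element of the total complex. -/
noncomputable def toFamily (n : ℕ) :
    (K.total (ComplexShape.up ℕ)).X n ⟶ ModuleCat.of k (∀ i j, (K.X i).X j) :=
  K.totalDesc fun p q _ => ModuleCat.ofHom (K.single p q)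

theorem toFamily_ι (p q n : ℕ) (h : p + q = n) (x : (K.X p).X q) :
    (K.toFamily n).hom ((K.ιTotal (ComplexShape.up ℕ) p q n h).hom x) = K.single p q x :=
  congrArg (fun t => t.hom x) (K.ι_totalDesc (c₁₂ := ComplexShape.up ℕ) (i₁₂ := n)
    (fun p q _ => ModuleCat.ofHom (K.single p q)) p q h)

theorem ι_d (p q n : ℕ) (h : p + q = n) (x : (K.X p).X q) :
    ((K.total (ComplexShape.up ℕ)).d n (n + 1)).hom
        ((K.ιTotal (ComplexShape.up ℕ) p q n h).hom x) =
      (K.ιTotal (ComplexShape.up ℕ) (p + 1) q (n + 1)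
        (show p + 1 + q = n + 1 by lia)).hom (((K.d p (p + 1)).f q).hom x) +
      (-1 : ℤ) ^ p • (K.ιTotal (ComplexShape.up ℕ) p (q + 1) (n + 1)
        (show p + (q + 1) = n + 1 by lia)).hom (((K.X p).d q (q + 1)).hom x) := by
  have : K.ιTotal (ComplexShape.up ℕ) p q n h ≫ (K.total (ComplexShape.up ℕ)).d n (n + 1) =
      ((K.d p (p + 1)).f q ≫ K.ιTotal (ComplexShape.up ℕ) (p + 1) q (n + 1)
        (show p + 1 + q = n + 1 by lia)) +
      (-1 : ℤ) ^ p • ((K.X p).d q (q + 1) ≫ K.ιTotal (ComplexShape.up ℕ) p (q + 1) (n + 1)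
        (show p + (q + 1) = n + 1 by lia)) := by
    rw [total_d, Preadditive.comp_add, ι_D₁, ι_D₂,
      K.d₁_eq (ComplexShape.up ℕ) (i₁ := p) (i₁' := p + 1) rfl q (n + 1)
        (show p + 1 + q = n + 1 by lia),
      K.d₂_eq (ComplexShape.up ℕ) p (i₂ := q) (i₂' := q + 1) rfl (n + 1)
        (show p + (q + 1) = n + 1 by lia)]
    congr 1
    exact one_smul _ _
  exact congrArg (fun t => t.hom x) this

theorem toFamily_d (n : ℕ) (t : (K.total (ComplexShape.up ℕ)).X n) :
    (K.toFamily (n + 1)).hom (((K.total (ComplexShape.up ℕ)).d n (n + 1)).hom t) =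
      K.familyD ((K.toFamily n).hom t) := by
  have : (K.total (ComplexShape.up ℕ)).d n (n + 1) ≫ K.toFamily (n + 1) =
      K.toFamily n ≫ ModuleCat.ofHom K.familyD := by
    apply total.hom_ext
    intro p q h
    ext x : 2
    change (K.toFamily (n + 1)).hom (((K.total (ComplexShape.up ℕ)).d n (n + 1)).hom
      ((K.ιTotal (ComplexShape.up ℕ) p q n h).hom x)) =
        K.familyD ((K.toFamily n).hom ((K.ιTotal (ComplexShape.up ℕ) p q n h).hom x))
    rw [ι_d, map_add, map_zsmul, toFamily_ι, toFamily_ι, toFamily_ι, familyD_single]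
  exact congrArg (fun s => s.hom t) this

/-- The element of the total complex with given components. -/
noncomputable def ofFamily (n : ℕ) :
    (∀ i j, (K.X i).X j) →ₗ[k] (K.total (ComplexShape.up ℕ)).X n :=
  ∑ ij ∈ Finset.HasAntidiagonal.antidiagonal n,
    -- `ιTotalOrZero` spares a proof of `i + j = n` for each summand.
    (K.ιTotalOrZero (ComplexShape.up ℕ) ij.1 ij.2 n).hom ∘ₗ LinearMap.proj (φ := fun j => (K.X ij.1).X j) ij.2 ∘ₗ
      LinearMap.proj (φ := fun i => ∀ j, (K.X i).X j) ij.1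

theorem ofFamily_apply (n : ℕ) (x : ∀ i j, (K.X i).X j) :
    K.ofFamily n x = ∑ ij ∈ Finset.HasAntidiagonal.antidiagonal n,
      (K.ιTotalOrZero (ComplexShape.up ℕ) ij.1 ij.2 n).hom (x ij.1 ij.2) := by
  simp [ofFamily]

theorem ofFamily_toFamily (n : ℕ) (t : (K.total (ComplexShape.up ℕ)).X n) :
    K.ofFamily n ((K.toFamily n).hom t) = t := by
  have : K.toFamily n ≫ ModuleCat.ofHom (K.ofFamily n) = 𝟙 _ := by
    apply total.hom_ext
    intro p q h
    ext x : 2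
    change K.ofFamily n ((K.toFamily n).hom ((K.ιTotal (ComplexShape.up ℕ) p q n h).hom x)) =
      (K.ιTotal (ComplexShape.up ℕ) p q n h).hom x
    rw [toFamily_ι, ofFamily_apply, Finset.sum_eq_single (p, q)]
    · rw [K.ιTotalOrZero_eq (ComplexShape.up ℕ) p q n h, single_same]
    · rintro ⟨i, j⟩ - hij
      rw [K.single_of_ne (by simpa using hij), map_zero]
    · intro hn
      exact absurd (Finset.HasAntidiagonal.mem_antidiagonal.2 h) hn
  exact congrArg (fun s => s.hom t) this

theorem toFamily_injective (n : ℕ) : Function.Injective (K.toFamily n).hom :=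
  Function.LeftInverse.injective (K.ofFamily_toFamily n)

theorem toFamily_mem (n : ℕ) (t : (K.total (ComplexShape.up ℕ)).X n) :
    (K.toFamily n).hom t ∈ K.familyF 0 n := by
  rw [← K.ofFamily_toFamily n t, ofFamily_apply, map_sum]
  refine Submodule.sum_mem _ fun ij hij => ?_
  obtain ⟨p, q⟩ := ij
  have h : p + q = n := Finset.HasAntidiagonal.mem_antidiagonal.1 hij
  rw [K.ιTotalOrZero_eq (ComplexShape.up ℕ) p q n h, toFamily_ι]
  intro i j hij'
  exact K.single_of_ne (by lia) _

theorem exists_toFamily_eq {n : ℕ} {x : ∀ i j, (K.X i).X j} (hx : x ∈ K.familyF 0 n) :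
    ∃ t, (K.toFamily n).hom t = x := by
  refine ⟨K.ofFamily n x, ?_⟩
  rw [ofFamily_apply, map_sum]
  have (ij : ℕ × ℕ) (hij : ij ∈ Finset.HasAntidiagonal.antidiagonal n) : (K.toFamily n).hom
      ((K.ιTotalOrZero (ComplexShape.up ℕ) ij.1 ij.2 n).hom (x ij.1 ij.2)) =
        K.single ij.1 ij.2 (x ij.1 ij.2) := by
    rw [K.ιTotalOrZero_eq (ComplexShape.up ℕ) ij.1 ij.2 n
        (Finset.HasAntidiagonal.mem_antidiagonal.1 hij),
      toFamily_ι]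
  rw [Finset.sum_congr rfl this]
  funext i j
  simp only [Finset.sum_apply]
  by_cases h : i + j = n
  · rw [Finset.sum_eq_single (i, j)]
    · exact K.single_same i j _
    · rintro ⟨p, q⟩ - hpq
      exact K.single_of_ne (by rintro ⟨rfl, rfl⟩; exact hpq rfl) _
    · intro hn
      exact absurd (Finset.HasAntidiagonal.mem_antidiagonal.2 h) hn
  · rw [hx i j (by lia)]
    refine Finset.sum_eq_zero ?_
    rintro ⟨p, q⟩ hpq
    have := Finset.HasAntidiagonal.mem_antidiagonal.1 hpq
    exact K.single_of_ne (by rintro ⟨rfl, rfl⟩; exact h this) _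

/-- The components of a cycle of the total complex. -/
noncomputable def cyclesToFamily (n : ℕ) :
    (K.total (ComplexShape.up ℕ)).cycles n →ₗ[k] ∀ i j, (K.X i).X j :=
  ((K.total (ComplexShape.up ℕ)).iCycles n ≫ K.toFamily n).hom

theorem cyclesToFamily_injective (n : ℕ) : Function.Injective (K.cyclesToFamily n) :=
  (K.toFamily_injective n).comp ((K.total (ComplexShape.up ℕ)).iCycles_injective n)

theorem familyD_cyclesToFamily (n : ℕ) (z : (K.total (ComplexShape.up ℕ)).cycles n) :
    K.familyD (K.cyclesToFamily n z) = 0 := by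
  change K.familyD ((K.toFamily n).hom (((K.total (ComplexShape.up ℕ)).iCycles n).hom z)) = 0
  rw [← toFamily_d, HomologicalComplex.d_iCycles_apply, map_zero]

theorem exists_cyclesToFamily_eq {n : ℕ} {x : ∀ i j, (K.X i).X j} (hx : x ∈ K.familyF 0 n)
    (hd : K.familyD x = 0) : ∃ z, K.cyclesToFamily n z = x := by
  obtain ⟨t, rfl⟩ := K.exists_toFamily_eq hx
  rw [← toFamily_d] at hd
  obtain ⟨z, rfl⟩ := (K.total (ComplexShape.up ℕ)).exists_cycle (i := n) (j := n + 1) (by simp) t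
    (K.toFamily_injective _ (hd.trans (map_zero _).symm))
  exact ⟨z, rfl⟩

/-- `toFamily` is injective with image `familyF 0 n`, so boundaries can be tested on families. Since
`n - 1` is an integer, `n = 0` refers to degree `-1`, where only the zero family lives. -/
theorem homologyπ_total_eq_zero_iff (n : ℕ) (z : (K.total (ComplexShape.up ℕ)).cycles n) :
    ((K.total (ComplexShape.up ℕ)).homologyπ n).hom z = 0 ↔
      ∃ b ∈ K.familyF 0 (n - 1), K.familyD b = K.cyclesToFamily n z := by
  rw [HomologicalComplex.homologyπ_apply_eq_zero_iff _ rfl]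
  cases n with
  | zero =>
    rw [(K.total (ComplexShape.up ℕ)).shape _ 0 (by simp)]
    constructor
    · rintro ⟨y, hy⟩
      refine ⟨0, zero_mem _, ?_⟩
      rw [map_zero]
      refine ((congrArg (K.toFamily 0).hom hy).symm.trans ?_).symm
      exact map_zero _
    · rintro ⟨b, hb, hbz⟩
      have hb0 : b = 0 := by
        funext i j
        exact hb i j (by push_cast; lia)
      rw [hb0, map_zero, eq_comm] at hbz
      refine ⟨0, (K.toFamily_injective 0 (Eq.trans hbz ?_)).symm⟩
      exact (map_zero _).symm
  | succ n =>
    rw [show (ComplexShape.up ℕ).prev (n + 1) = n by simp,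
      show ((n + 1 : ℕ) : ℤ) - 1 = n by push_cast; lia]
    constructor
    · rintro ⟨y, hy⟩
      refine ⟨_, K.toFamily_mem n y, ?_⟩
      rw [← toFamily_d, hy]
      rfl
    · rintro ⟨b, hb, hbz⟩
      obtain ⟨y, rfl⟩ := K.exists_toFamily_eq hb
      rw [← toFamily_d] at hbz
      exact ⟨y, K.toFamily_injective _ hbz⟩

/-- The cycles of the total complex that lie in a step of the filtration by the first degree. -/
noncomputable def filtrationCycles (n p : ℕ) :
    Submodule k ((K.total (ComplexShape.up ℕ)).cycles n) :=
  (K.familyF p n).comap (K.cyclesToFamily n)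

/-- The filtration of the cohomology of the total complex by the first degree. -/
noncomputable def filtration (n p : ℕ) : Submodule k ((K.total (ComplexShape.up ℕ)).homology n) :=
  (K.filtrationCycles n p).map ((K.total (ComplexShape.up ℕ)).homologyπ n).hom

theorem filtration_antitone (n : ℕ) : Antitone (K.filtration n) := fun _ _ h =>
  Submodule.map_mono (Submodule.comap_mono (K.filteredDifferential.anti n (by exact_mod_cast h)))

theorem filtration_zero (n : ℕ) : K.filtration n 0 = ⊤ := by
  have : K.filtrationCycles n 0 = ⊤ := by
    rw [eq_top_iff]
    intro z _
    exact K.toFamily_mem n _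
  rw [filtration, this, Submodule.map_top, LinearMap.range_eq_top]
  exact HomologicalComplex.homologyπ_surjective _ _

theorem filtration_succ_self (n : ℕ) : K.filtration n (n + 1) = ⊥ := by
  have : K.filtrationCycles n (n + 1) = ⊥ := by
    rw [eq_bot_iff]
    intro z hz
    have hz' : K.cyclesToFamily n z = 0 :=
      K.filteredDifferential.eq_zero_of_mem_F hz (by push_cast; lia)
    exact K.cyclesToFamily_injective n (hz'.trans (map_zero _).symm)
  rw [filtration, this, Submodule.map_bot]

/-- The graded pieces of the filtration of the cohomology of the total complex are the terms
`E_∞` of the spectral sequence. -/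
noncomputable def filtrationQuotientEquiv {r : ℤ} (p q : ℕ) (hp : (p + 1 : ℤ) ≤ r)
    (hq : (q + 2 : ℤ) ≤ r) :
    K.filteredDifferential.E r p (p + q) ≃ₗ[k]
      (K.filtration (p + q) p ⧸
        (K.filtration (p + q) (p + 1)).submoduleOf (K.filtration (p + q) p)) := by
  have hZ (z : K.filtrationCycles (p + q) p) :
      K.cyclesToFamily (p + q) z ∈ K.filteredDifferential.Z r p (p + q) :=
    FilteredDifferential.mem_Z_of_d_eq_zero (S := K.filteredDifferential)
      (by have := z.2; exact_mod_cast this) (K.familyD_cyclesToFamily _ _)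
  have hF (z : K.filtrationCycles (p + q) p) :
      ((K.total (ComplexShape.up ℕ)).homologyπ (p + q)).hom z ∈ K.filtration (p + q) p :=
    Submodule.mem_map_of_mem z.2
  -- The common source is the module of cycles in `F^p`. It maps onto `E_r` because `r ≥ q + 2`
  -- makes `Z_r` consist of cycles. Both kernels consist of the cycles homologous to a cycle in
  -- `F^{p+1}`.
  refine LinearMap.equivOfKerEq (N := K.filtrationCycles (p + q) p)
    (Submodule.mkQ _ ∘ₗ LinearMap.codRestrict _
      (K.cyclesToFamily (p + q) ∘ₗ (K.filtrationCycles (p + q) p).subtype) hZ)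
    (Submodule.mkQ _ ∘ₗ LinearMap.codRestrict _
      (((K.total (ComplexShape.up ℕ)).homologyπ (p + q)).hom ∘ₗ
        (K.filtrationCycles (p + q) p).subtype) hF) ?_ ?_ ?_
  · refine (Submodule.mkQ_surjective _).comp ?_
    rintro ⟨x, hx⟩
    obtain ⟨hxF, hxd⟩ := (K.filteredDifferential.mem_Z_iff_of_lt (by lia)).1 hx
    obtain ⟨z, rfl⟩ := K.exists_cyclesToFamily_eq (n := p + q)
      (FilteredDifferential.F_le_of_nonpos (S := K.filteredDifferential) (p := p) le_rfl
        (by exact_mod_cast hxF)) hxd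
    exact ⟨⟨z, by exact_mod_cast hxF⟩, rfl⟩
  · refine (Submodule.mkQ_surjective _).comp ?_
    rintro ⟨x, z, hz, rfl⟩
    exact ⟨⟨z, hz⟩, rfl⟩
  · intro z
    refine (FilteredDifferential.mk_eq_zero_iff (S := K.filteredDifferential) ⟨_, hZ z⟩).trans ?_
    rw [K.filteredDifferential.mem_B_iff_of_lt (by lia) hp (hZ z)]
    refine Iff.trans ?_ (Submodule.Quotient.mk_eq_zero _).symm
    refine Iff.trans ?_ (Submodule.mem_map
      (f := ((K.total (ComplexShape.up ℕ)).homologyπ (p + q)).hom)).symm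
    constructor
    · rintro ⟨a, ha, b, hb, had, hab⟩
      obtain ⟨w, rfl⟩ := K.exists_cyclesToFamily_eq (n := p + q)
        (FilteredDifferential.F_le_of_nonpos (S := K.filteredDifferential) (p := p + 1) le_rfl
          (by exact_mod_cast ha)) had
      have h : ((K.total (ComplexShape.up ℕ)).homologyπ (p + q)).hom (z - w) = 0 := by
        rw [homologyπ_total_eq_zero_iff]
        refine ⟨b, by exact_mod_cast hb, ?_⟩
        rw [map_sub, eq_sub_iff_add_eq']
        exact hab
      rw [map_sub, sub_eq_zero] at h
      exact ⟨w, by exact_mod_cast ha, h.symm⟩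
    · rintro ⟨w, hw, hwz⟩
      have h : ((K.total (ComplexShape.up ℕ)).homologyπ (p + q)).hom (z - w) = 0 := by
        rw [map_sub, sub_eq_zero]
        exact hwz.symm
      obtain ⟨b, hb, hbz⟩ := (K.homologyπ_total_eq_zero_iff _ _).1 h
      refine ⟨K.cyclesToFamily _ w, by exact_mod_cast hw, b, by exact_mod_cast hb,
        K.familyD_cyclesToFamily _ w, ?_⟩
      change _ + K.familyD b = _
      rw [hbz, map_sub, add_sub_cancel]

end HomologicalComplex₂

/-! ### The second page -/

namespace HomologicalComplex₂

variable {k : Type u} [Ring k]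
  (K : HomologicalComplex₂ (ModuleCat.{u} k) (ComplexShape.up ℕ) (ComplexShape.up ℕ))

theorem neg_one_pow_zsmul_eq_zero_iff {X : Type*} [AddCommGroup X] (p : ℕ) (x : X) :
    (-1 : ℤ) ^ p • x = 0 ↔ x = 0 := by
  rcases neg_one_pow_eq_or ℤ p with h | h <;> simp [h]

theorem neg_one_pow_zsmul_self {X : Type*} [AddCommGroup X] (p : ℕ) (x : X) :
    (-1 : ℤ) ^ p • (-1 : ℤ) ^ p • x = x := by
  rcases neg_one_pow_eq_or ℤ p with h | h <;> simp [h]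

/-- In the lowest column the horizontal term would come from column `p - 1`, where `x` vanishes. -/
theorem familyD_apply_of_mem {p : ℕ} {n : ℤ} {x : ∀ i j, (K.X i).X j} (hx : x ∈ K.familyF p n)
    (j : ℕ) : K.familyD x p j = (-1 : ℤ) ^ p • ((K.X p).d (j - 1) j).hom (x p (j - 1)) := by
  rw [familyD_apply, add_eq_right]
  cases p with
  | zero => exact K.d_pred_zero_apply _ _
  | succ p => rw [hx _ _ (by push_cast; simp), map_zero]

theorem mem_familyF_succ {p q : ℕ} {n : ℤ} {x : ∀ i j, (K.X i).X j} (hx : x ∈ K.familyF p n)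
    (hn : (p + q : ℤ) = n) (h : x p q = 0) : x ∈ K.familyF (p + 1) n := by
  intro i j hij
  by_cases hij' : i = p ∧ j = q
  · obtain ⟨rfl, rfl⟩ := hij'
    exact h
  · exact hx i j (by lia)

theorem single_mem {p q : ℕ} {n : ℤ} (hn : (p + q : ℤ) = n) (x : (K.X p).X q) :
    K.single p q x ∈ K.familyF p n := fun i j h => K.single_of_ne (by lia) x

theorem familyD_mem {p n n' : ℤ} {x : ∀ i j, (K.X i).X j} (hx : x ∈ K.familyF p n)
    (hn : n + 1 = n') : K.familyD x ∈ K.familyF p n' := by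
  subst hn
  exact K.filteredDifferential.d_mem hx

theorem familyD_single_apply (p q : ℕ) (x : (K.X p).X q) :
    K.familyD (K.single p q x) (p + 1) q = ((K.d p (p + 1)).f q).hom x := by
  rw [familyD_single]
  change K.single (p + 1) q _ (p + 1) q + (-1 : ℤ) ^ p • K.single p (q + 1) _ (p + 1) q = _
  rw [single_same, K.single_of_ne (by lia), smul_zero, add_zero]

theorem familyD_single_mem {p q : ℕ} {n : ℤ} (hn : (p + q + 1 : ℤ) = n) (x : (K.X p).X q)
    (hx : ((K.X p).d q (q + 1)).hom x = 0) :
    K.familyD (K.single p q x) ∈ K.familyF (p + 1 : ℕ) n := by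
  rw [familyD_single, hx, map_zero, smul_zero, add_zero]
  exact K.single_mem (by push_cast; lia) _

/-- Vertical boundaries are leading entries of total boundaries from the same column: take the
family with the single entry `y`, with the sign `(-1)^p` to cancel that of the total differential.
-/
theorem exists_familyD_apply_eq (p q : ℕ) {n : ℤ} (hn : (p + q : ℤ) = n + 1)
    (y : (K.X p).X (q - 1)) :
    ∃ b ∈ K.familyF p n, K.familyD b p q = ((K.X p).d (q - 1) q).hom y := by
  cases q with
  | zero => exact ⟨0, zero_mem _, by rw [map_zero, X_d_pred_zero_apply]; rfl⟩
  | succ q =>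
    have hb : (-1 : ℤ) ^ p • K.single p q y ∈ K.familyF p n :=
      zsmul_mem (K.single_mem (by push_cast at hn; lia) _) _
    refine ⟨_, hb, ?_⟩
    rw [K.familyD_apply_of_mem hb]
    change (-1 : ℤ) ^ p • ((K.X p).d q (q + 1)).hom ((-1 : ℤ) ^ p • K.single p q y p q) = _
    rw [map_zsmul, neg_one_pow_zsmul_self, single_same]
    rfl

theorem d_apply_eq_zero_of_familyD_mem {p q : ℕ} {n : ℤ} {x : ∀ i j, (K.X i).X j}
    (hx : x ∈ K.familyF p n) (hd : K.familyD x ∈ K.familyF (p + 1 : ℕ) (n + 1)) :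
    ((K.X p).d q (q + 1)).hom (x p q) = 0 := by
  have h := K.familyD_apply_of_mem hx (q + 1)
  rw [hd p (q + 1) (by lia)] at h
  exact (neg_one_pow_zsmul_eq_zero_iff p _).1 h.symm

variable (L : CochainComplex (ModuleCat.{u} k) ℕ) {q : ℕ}
  (cl : ∀ p, LinearMap.ker ((K.X p).d q (q + 1)).hom →ₗ[k] L.X p)

/-- In `mem_B_two_iff`, the entry `b_{p-1,q}` is a vertical cycle because `D b` lies in `F^p`, and
comparing entries at `(p, q)` gives `z_{pq} = d_h b_{p-1,q} ± d_v b_{p,q-1}`. So `z` is in `B_2`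
exactly if the class of `z_{pq}` is the `L`-differential of a class, represented by `b_{p-1,q}`. For
`p = 0` there is no previous column, and the condition is that `z_{0q}` is a vertical boundary. -/
theorem mem_B_two_iff_exists (hs : ∀ p, Function.Surjective (cl p))
    (h0 : ∀ p z, cl p z = 0 ↔ ∃ y : (K.X p).X (q - 1), ((K.X p).d (q - 1) q).hom y = z)
    (hd : ∀ p z w, ((K.d p (p + 1)).f q).hom z.1 = w.1 →
      (L.d p (p + 1)).hom (cl p z) = cl (p + 1) w) (p : ℕ) {z : ∀ i j, (K.X i).X j}
    (hz : z ∈ K.filteredDifferential.Z 2 p (p + q))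
    (hk : z p q ∈ LinearMap.ker ((K.X p).d q (q + 1)).hom) :
    z ∈ K.filteredDifferential.B 2 p (p + q) ↔
      ∃ y : L.X (p - 1), (L.d (p - 1) p).hom y = cl p ⟨z p q, hk⟩ := by
  have heq (p : ℕ) (x y : LinearMap.ker ((K.X p).d q (q + 1)).hom) :
      cl p x = cl p y ↔ ∃ w : (K.X p).X (q - 1), ((K.X p).d (q - 1) q).hom w = x - y := by
    rw [← sub_eq_zero, ← map_sub, h0]; rfl
  rw [FilteredDifferential.mem_B_two_iff hz]
  change (∃ b ∈ K.familyF (p - 1) (p + q - 1), K.familyD b ∈ K.familyF p (p + q) ∧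
    z - K.familyD b ∈ K.familyF (p + 1) (p + q)) ↔ _
  have hval {b} (hb : z - K.familyD b ∈ K.familyF (p + 1) (p + q)) : K.familyD b p q = z p q :=
    (sub_eq_zero.1 (hb p q (by lia))).symm
  cases p with
  | zero =>
    have hL (y) : (L.d (0 - 1) 0).hom y = 0 :=
      congrArg (fun t => t.hom y) (L.shape (0 - 1) 0 (by simp))
    simp only [hL, exists_const, eq_comm (a := (0 : L.X 0)), h0]
    constructor
    · rintro ⟨b, hb, -, hzb⟩
      refine ⟨b 0 (q - 1), ?_⟩
      rw [← hval hzb, K.familyD_apply_of_mem (n := (0 : ℕ) + q - 1), pow_zero, one_smul]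
      exact FilteredDifferential.F_le_of_nonpos (S := K.filteredDifferential) le_rfl hb
    · rintro ⟨y, hy⟩
      obtain ⟨b, hb, hby⟩ := K.exists_familyD_apply_eq 0 q (n := (0 : ℕ) + q - 1) (by lia) y
      have hDb := K.familyD_mem hb (n' := (0 : ℕ) + q) (by lia)
      refine ⟨b, K.filteredDifferential.anti _ (by lia) hb, hDb,
        K.mem_familyF_succ (sub_mem hz.1 hDb) rfl ?_⟩
      rw [Pi.sub_apply, Pi.sub_apply, hby, hy, sub_self]
  | succ p =>
    rw [show (((p + 1 : ℕ) : ℤ) - 1) = p by lia, show (((p + 1 : ℕ) : ℤ) + q - 1) = p + q by lia]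
    have hd0 (a : LinearMap.ker ((K.X p).d q (q + 1)).hom) :
        ((K.X (p + 1)).d q (q + 1)).hom (((K.d p (p + 1)).f q).hom a) = 0 := by
      rw [← d_comm_apply, a.2, map_zero]
    constructor
    · rintro ⟨b, hb, hDb, hzb⟩
      have hb0 : ((K.X p).d q (q + 1)).hom (b p q) = 0 :=
        K.d_apply_eq_zero_of_familyD_mem hb (by convert hDb using 2; lia)
      refine ⟨cl p ⟨b p q, hb0⟩, (hd p _ ⟨_, hd0 ⟨b p q, hb0⟩⟩ rfl).trans ((heq _ _ _).2 ?_)⟩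
      refine ⟨-((-1 : ℤ) ^ (p + 1) • b (p + 1) (q - 1)), ?_⟩
      rw [map_neg, map_zsmul, eq_sub_iff_add_eq', ← sub_eq_add_neg, sub_eq_iff_eq_add]
      exact (hval hzb).symm.trans (K.familyD_apply _ _ _)
    · rintro ⟨y, hy⟩
      obtain ⟨c, rfl⟩ := hs p y
      replace hy := hy.symm.trans (hd p c ⟨_, hd0 c⟩ rfl)
      obtain ⟨w, hw⟩ := (heq _ _ _).1 hy
      obtain ⟨b, hb, hbw⟩ := K.exists_familyD_apply_eq (p + 1) q (n := p + q) (by lia) w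
      have hD : K.familyD (K.single p q c.1 + b) ∈ K.familyF (p + 1 : ℕ) ((p + 1 : ℕ) + q) := by
        rw [map_add]
        exact add_mem (K.familyD_single_mem (by lia) _ c.2) (K.familyD_mem hb (by lia))
      -- The cycle `c` represents `y`, and `b` supplies the vertical boundary by which `d_h c`
      -- differs from the leading entry of `z`.
      refine ⟨K.single p q c.1 + b, add_mem (K.single_mem rfl _)
        (K.filteredDifferential.anti _ (by lia) hb), hD,
        K.mem_familyF_succ (sub_mem hz.1 hD) rfl ?_⟩
      rw [map_add, Pi.sub_apply, Pi.sub_apply, Pi.add_apply, Pi.add_apply, familyD_single_apply,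
        hbw, hw]
      exact sub_eq_zero.2 (add_sub_cancel _ _).symm

/-- If the terms of a complex `L` are the vertical cohomology of a double complex in one degree, and
its differential is induced by the horizontal one, then its homology is the corresponding row of
the second page of the spectral sequence. -/
noncomputable def secondPageIso (hs : ∀ p, Function.Surjective (cl p))
    (h0 : ∀ p z, cl p z = 0 ↔ ∃ y : (K.X p).X (q - 1), ((K.X p).d (q - 1) q).hom y = z)
    (hd : ∀ p z w, ((K.d p (p + 1)).f q).hom z.1 = w.1 →
      (L.d p (p + 1)).hom (cl p z) = cl (p + 1) w) (p : ℕ) :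
    L.homology p ≅ ModuleCat.of k (K.filteredDifferential.E 2 p (p + q)) := by
  have hker (z : K.filteredDifferential.Z 2 p (p + q)) :
      ((K.X p).d q (q + 1)).hom (z.1 p q) = 0 :=
    K.d_apply_eq_zero_of_familyD_mem z.2.1
      (K.filteredDifferential.anti _ (by push_cast; lia) z.2.2)
  have hd0 (p : ℕ) (a : LinearMap.ker ((K.X p).d q (q + 1)).hom) :
      ((K.X (p + 1)).d q (q + 1)).hom (((K.d p (p + 1)).f q).hom a) = 0 := by
    rw [← d_comm_apply, a.2, map_zero]
  let ev : K.filteredDifferential.Z 2 p (p + q) →ₗ[k] (K.X p).X q :=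
    LinearMap.proj (φ := fun j => (K.X p).X j) q ∘ₗ
      LinearMap.proj (φ := fun i => ∀ j, (K.X i).X j) p ∘ₗ Submodule.subtype _
  refine L.homologyIsoOf (i' := p - 1) (j := p + 1) (by cases p <;> simp) (by simp)
    (N := K.filteredDifferential.Z 2 p (p + q)) (cl p ∘ₗ ev.codRestrict _ hker)
    (Submodule.mkQ _) (Submodule.mkQ_surjective _) ?_ ?_ ?_
  · intro z
    refine (hd p _ ⟨_, hd0 p ⟨_, hker z⟩⟩ rfl).trans ((h0 _ _).2 ?_)
    -- As `D z` lies in `F^{p+2}`, its entry at `(p+1, q)` is zero; this writes `d_h z_{pq}` as a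
    -- vertical boundary.
    refine ⟨-((-1 : ℤ) ^ (p + 1) • z.1 (p + 1) (q - 1)), ?_⟩
    have h : K.familyD z.1 (p + 1) q = 0 := z.2.2 (p + 1) q (by push_cast; lia)
    rw [familyD_apply] at h
    rw [map_neg, map_zsmul, neg_eq_iff_add_eq_zero]
    exact (add_comm _ _).trans h
  · intro x hx
    obtain ⟨a, rfl⟩ := hs p x
    rw [hd p a ⟨_, hd0 p a⟩ rfl, h0] at hx
    obtain ⟨y, hy⟩ := hx
    obtain ⟨b, hb, hby⟩ := K.exists_familyD_apply_eq (p + 1) q (n := p + q) (by push_cast; lia) y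
    have hDb := K.familyD_mem hb rfl
    -- The class of `a` is an `L`-cycle, so `d_h a = d_v y`. Subtracting `b`, which lives in columns
    -- `≥ p + 1`, cancels this entry without changing the leading entry `a`.
    have hz : K.single p q a.1 - b ∈ K.filteredDifferential.Z 2 p (p + q) := by
      refine ⟨sub_mem (K.single_mem rfl _)
        (K.filteredDifferential.anti _ (by push_cast; lia) hb), ?_⟩
      have := K.mem_familyF_succ (q := q) (x := K.familyD (K.single p q a.1 - b)) (p := p + 1)
        (n := p + q + 1) (by rw [map_sub]; exact sub_mem (K.familyD_single_mem rfl _ a.2) hDb)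
        (by push_cast; lia) (by
          rw [map_sub, Pi.sub_apply, Pi.sub_apply, familyD_single_apply, hby, hy, sub_self])
      rwa [show (((p + 1 : ℕ) : ℤ) + 1) = p + 2 by push_cast; lia] at this
    refine ⟨⟨_, hz⟩, congrArg (cl p) (Subtype.ext ?_)⟩
    change K.single p q a.1 p q - b p q = a
    rw [single_same, hb p q (by push_cast; lia), sub_zero]
  · intro z
    exact (FilteredDifferential.mk_eq_zero_iff z).trans
      (K.mem_B_two_iff_exists L cl hs h0 hd p z.2 (hker z))

end HomologicalComplex₂

/-! ### The spectral sequence of a functor from the category of morphisms to complexes -/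

namespace GlobalHochschild

section

variable {k : Type u} [Field k] {C : Type u} [SmallCategory C]
  (K : Mor C ⥤ CochainComplex (ModuleCat.{u} k) ℕ)

/-- The inclusion of the cycles, as a morphism of functors. -/
noncomputable def cyclesInclusion (q : ℕ) :
    K ⋙ HomologicalComplex.cyclesFunctor _ _ q ⟶ K ⋙ HomologicalComplex.eval _ _ q where
  app f := (K.obj f).iCycles q
  naturality _ _ a := HomologicalComplex.cyclesMap_i (K.map a) q

/-- The projection from cycles to homology, as a morphism of functors. -/
noncomputable def cyclesProjection (q : ℕ) :
    K ⋙ HomologicalComplex.cyclesFunctor _ _ q ⟶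
      K ⋙ HomologicalComplex.homologyFunctor _ _ q where
  app f := (K.obj f).homologyπ q
  naturality _ _ a := (HomologicalComplex.homologyπ_naturality (K.map a) q).symm

/-- The map from the cycles for the second differential to cochains with values in homology. -/
noncomputable def cochainClass (q p : ℕ) :
    LinearMap.ker (((resolvingBicomplex K).X p).d q (q + 1)).hom →ₗ[k]
      (resolvingComplex (K ⋙ HomologicalComplex.homologyFunctor _ _ q)).X p :=
  LinearMap.pi fun x : ComposableArrows C p =>
    (K.obj (composite x)).homologyClass q (q + 1) (by simp) ∘ₗ
      LinearMap.codRestrict _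
        ((LinearMap.proj x : Cochain (K ⋙ HomologicalComplex.eval _ _ q) p →ₗ[k] _) ∘ₗ
          Submodule.subtype _) (fun z => congrFun z.2 x)

theorem cochainClass_apply (q p : ℕ)
    (z : LinearMap.ker (((resolvingBicomplex K).X p).d q (q + 1)).hom) (x : ComposableArrows C p) :
    cochainClass K q p z x =
      (K.obj (composite x)).homologyClass q (q + 1) (by simp) ⟨z.1 x, congrFun z.2 x⟩ := rfl

theorem cochainClass_eq {q p : ℕ}
    (z : LinearMap.ker (((resolvingBicomplex K).X p).d q (q + 1)).hom)
    (ζ : Cochain (K ⋙ HomologicalComplex.cyclesFunctor _ _ q) p)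
    (h : Cochain.push (cyclesInclusion K q) p ζ = z.1) :
    cochainClass K q p z = Cochain.push (cyclesProjection K q) p ζ := by
  funext x
  rw [cochainClass_apply]
  exact (K.obj (composite x)).homologyClass_eq (by simp) (ζ x) _ (congrFun h x)

theorem exists_push_cyclesInclusion {q p : ℕ}
    (z : LinearMap.ker (((resolvingBicomplex K).X p).d q (q + 1)).hom) :
    ∃ ζ, Cochain.push (cyclesInclusion K q) p ζ = z.1 := by
  choose ζ hζ using fun x : ComposableArrows C p =>
    (K.obj (composite x)).exists_cycle (i := q) (j := q + 1) (by simp) (z.1 x) (congrFun z.2 x)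
  exact ⟨ζ, funext hζ⟩

/-- Representatives can be chosen independently for each chain, since a cochain is an arbitrary
family; this is the exactness of products. -/
theorem cochainClass_surjective (q p : ℕ) : Function.Surjective (cochainClass K q p) := by
  intro c
  choose z hz using fun x : ComposableArrows C p =>
    (K.obj (composite x)).homologyClass_surjective q (q + 1) (by simp) (c x)
  exact ⟨⟨fun x => (z x).1, funext fun x => (z x).2⟩, funext hz⟩

theorem cochainClass_eq_zero_iff (q p : ℕ)
    (z : LinearMap.ker (((resolvingBicomplex K).X p).d q (q + 1)).hom) :
    cochainClass K q p z = 0 ↔ ∃ y : ((resolvingBicomplex K).X p).X (q - 1),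
      (((resolvingBicomplex K).X p).d (q - 1) q).hom y = z.1 := by
  have h (x : ComposableArrows C p) : cochainClass K q p z x = 0 ↔
      ∃ y, ((K.obj (composite x)).d (q - 1) q).hom y = z.1 x :=
    (K.obj (composite x)).homologyClass_eq_zero_iff (by cases q <;> simp) (by simp) _
  constructor
  · intro hz
    choose y hy using fun x => (h x).1 (congrFun hz x)
    exact ⟨y, funext hy⟩
  · rintro ⟨y, hy⟩
    exact funext fun x => (h x).2 ⟨y x, congrFun hy x⟩

/-- Lift `z` to a cochain `ζ` with values in the cycles functor. The inclusion of cycles and the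
projection to homology are both natural, so `Cochain.d` commutes with pushing `ζ` along either. -/
theorem d_cochainClass (q p : ℕ)
    (z : LinearMap.ker (((resolvingBicomplex K).X p).d q (q + 1)).hom)
    (w : LinearMap.ker (((resolvingBicomplex K).X (p + 1)).d q (q + 1)).hom)
    (h : (((resolvingBicomplex K).d p (p + 1)).f q).hom z.1 = w.1) :
    ((resolvingComplex (K ⋙ HomologicalComplex.homologyFunctor _ _ q)).d p (p + 1)).hom
      (cochainClass K q p z) = cochainClass K q (p + 1) w := by
  obtain ⟨ζ, hζ⟩ := exists_push_cyclesInclusion K z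
  rw [cochainClass_eq K z ζ hζ, cochainClass_eq K w (Cochain.d _ p ζ), resolvingComplex_d]
  · exact Cochain.push_d _ p ζ
  · rw [← Cochain.push_d, hζ, ← h]
    change _ = ((resolvingComplex (K ⋙ HomologicalComplex.eval _ _ q)).d p (p + 1)).hom _
    rw [resolvingComplex_d]
    rfl

end

end GlobalHochschild

/-! ### The main theorem. -/

theorem mainTheorem10 {k : Type u} [Field k] {C : Type u} [SmallCategory C]
    (A : C ⥤ AlgCat.{u} k) (F G : GlobalHochschild.ModulePresheaf A) :
    ∃ E : E₂CohomologicalSpectralSequenceNat (ModuleCat.{u} k),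
      (∀ p q : ℕ, Nonempty ((E.page 2).X (p, q) ≅
        GlobalHochschild.resolvingCohomology (GlobalHochschild.extFunctor F G q) p)) ∧
      ∃ Fil : ∀ n : ℕ, ℕ → Submodule k (GlobalHochschild.globalHochschildCohomology F G n),
        (∀ n, Antitone (Fil n)) ∧ (∀ n, Fil n 0 = ⊤) ∧ (∀ n, Fil n (n + 1) = ⊥) ∧
        ∀ p q : ℕ, Nonempty (GlobalHochschild.pageInfinity E p q ≅
          ModuleCat.of k (Fil (p + q) p ⧸
            (Fil (p + q) (p + 1)).submoduleOf (Fil (p + q) p))) := by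
  let K := GlobalHochschild.hochschildFunctor F G
  let D := GlobalHochschild.resolvingBicomplex K
  refine ⟨D.filteredDifferential.spectralSequence, fun p q => ⟨?_⟩, D.filtration,
    D.filtration_antitone, D.filtration_zero, D.filtration_succ_self, fun p q => ⟨?_⟩⟩
  · exact (D.secondPageIso _ (GlobalHochschild.cochainClass K q)
      (GlobalHochschild.cochainClass_surjective K q) (GlobalHochschild.cochainClass_eq_zero_iff K q)
      (GlobalHochschild.d_cochainClass K q) p).symm
  -- The page chosen in `pageInfinity` is the first to satisfy both bounds: `p + 1 ≤ r` for the
  -- boundaries and `q + 2 ≤ r` for the cycles.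
  · exact (D.filtrationQuotientEquiv (r := max (p + 1) (q + 2)) p q (le_max_left _ _)
      (le_max_right _ _)).toModuleIso
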